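/- Let $\mathbb T^2=(\mathbb R/2\pi\mathbb Z)^2$, $\varepsilon>0$, $\alpha\in\mathbb C$ with $\operatorname{Re}\alpha>0$, and $\delta>0$. For a distribution $u$ on $\mathbb T^2$ let $\hat u(k)=\langle u,e_k\rangle$, $k\in\mathbb Z^2$, be its Fourier coefficients, where $e_k(x)=\frac1{2\pi}e^{ik\cdot x}$; distributions are identified with their sequences of Fourier coefficients. Let $H^s=H^s(\mathbb T^2)$ be the space of distributions with $\|u\|_{H^s}^2=\sum_k(1+|k|^2)^s|\hat u(k)|^2<\infty$, and put $\mathcal H^{-\delta}=H^{-\delta}\times H^{-\delta-1}$. On a stochastic basis $(\Omega,\mathcal F,\mathbb P,(\mathcal F_t)_{t\ge0})$ let $W(t)=\sum_{k\in\mathbb Z^2}(\beta_{k,R}(t)+i\beta_{k,I}(t))e_k$ be a cylindrical Wiener process, where $\beta_{k,R},\beta_{k,I}$ are independent real standard $(\mathcal F_t)$-Brownian motions (with increments jointly independent of the past). Consider the linear stochastic damped Klein–Gordon equation $$\varepsilon^2\partial_t^2Z+2\alpha\,\partial_tZ+(1-\Delta)Z=2\sqrt{\operatorname{Re}\alpha}\;\partial_tW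 ,$$ that is, with $Y=\varepsilon\partial_tZ$, the system $$dZ=\varepsilon^{-1}Y\,dt,\qquad dY=\varepsilon^{-1}\{-2\alpha\varepsilon^{-1}Y-(1-\Delta)Z\}\,dt+2\varepsilon^{-1}\sqrt{\operatorname{Re}\alpha}\,dW ,$$ whose solutions are the adapted processes $(Z,Y)$ with almost surely continuous paths in $\mathcal H^{-\delta}$ that satisfy it in integrated form in the sense of distributions. Let $\mathcal N_c(0,r)$ be the law of $A+iB$ with $A,B$ independent real centred Gaussian variables of variance $r/2$, and let $$\mu=\bigotimes_{k\in\mathbb Z^2}\mathcal N_c\big(0,2(1+|k|^2)^{-1}\big)\otimes\bigotimes_{\ell\in\mathbb Z^2}\mathcal N_c(0,2)$$ be the product Gaussian measure on pairs $(z,y)$ of distributions, identified with their Fourier coefficients. Then: 1. for every $(z,y)\in\mathcal H^{-\delta}$ there is a solution $(Z,Y)$ with $(Z(0),Y(0))=(z,y)$; 2. $\mu$ is carried by $\mathcal H^{-\delta}$; 3. there is a semigroup $(P_t)_{t\ge0}$ of Markov kernels on $\mathcal H^{-\delta}$ such that every solution $X=(Z,Y)$ has the Markov property $\mathbb P(X(s+t)\in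 A\mid\mathcal F_s)=P_t(X(s),A)$ almost surely, for all $s,t\ge0$ and all Borel sets $A\subset\mathcal H^{-\delta}$; and $\mu$ is invariant for the Markov process $(Z,Y)$, that is, $\mu P_t=\mu$ for every $t\ge0$. -/

import Mathlib

open MeasureTheory ProbabilityTheory
open scoped NNReal ENNReal

noncomputable section

namespace KleinGordon

/-- The frequency lattice `ℤ²` of the torus `𝕋² = (ℝ/2πℤ)²`. -/
abbrev Freq : Type := ℤ × ℤ

/-- The symbol `1 + |k|²` of the operator `1 - Δ` on `𝕋²`. -/
def symb (k : Freq) : ℝ≥0 := 1 + ((k.1.natAbs : ℝ≥0) ^ 2 + (k.2.natAbs : ℝ≥0) ^ 2)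

/-- The Sobolev space `H^s(𝕋²)`. A distribution `u` on `𝕋²` is identified with the sequence
`(û(k))_{k ∈ ℤ²}` of its Fourier coefficients `û(k) = ⟨u, e_k⟩`, `e_k(x) = (2π)⁻¹ e^{i k · x}`, and
`u ∈ H^s` means `∑_k (1 + |k|²)^s |û(k)|² < ∞`. -/
@[ext]
structure Sobolev (s : ℝ) : Type where
  coeff : Freq → ℂ
  summable_coeff : Summable fun k => (symb k : ℝ) ^ s * ‖coeff k‖ ^ 2

namespace Sobolev

lemma symb_pos (k : Freq) : (0 : ℝ) < symb k := by
  unfold symb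
  positivity

lemma memlp {s : ℝ} (u : Sobolev s) :
    Memℓp (fun k => (((symb k : ℝ) ^ (s / 2) : ℝ) : ℂ) * u.coeff k) 2 := by
  refine memℓp_gen ?_
  refine u.summable_coeff.congr fun k => ?_
  have h := (symb_pos k).le
  have h2 : ((symb k : ℝ) ^ (s / 2)) ^ 2 = (symb k : ℝ) ^ s := by
    rw [← Real.rpow_natCast, ← Real.rpow_mul h]
    norm_num
  simp only [ENNReal.toReal_ofNat, Real.rpow_ofNat, norm_mul, Complex.norm_real, mul_pow,
    Real.norm_eq_abs, sq_abs, h2]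

/-- The isometry `u ↦ ((1 + |k|²)^{s/2} û(k))_k` from `H^s(𝕋²)` to `ℓ²(ℤ²)`, that is,
`u ↦ (1 - Δ)^{s/2} u`. -/
def toL2 {s : ℝ} (u : Sobolev s) : lp (fun _ : Freq => ℂ) 2 :=
  ⟨fun k => (((symb k : ℝ) ^ (s / 2) : ℝ) : ℂ) * u.coeff k, u.memlp⟩

lemma toL2_injective (s : ℝ) : Function.Injective (toL2 (s := s)) := by
  intro u v h
  ext k
  have hk := congrFun (congrArg Subtype.val h) k
  have hne : (((symb k : ℝ) ^ (s / 2) : ℝ) : ℂ) ≠ 0 :=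
    Complex.ofReal_ne_zero.2 (Real.rpow_pos_of_pos (symb_pos k) _).ne'
  exact mul_left_cancel₀ hne hk

/-- The distance `‖u - v‖_{H^s}`. -/
instance (s : ℝ) : MetricSpace (Sobolev s) :=
  MetricSpace.induced toL2 (toL2_injective s) inferInstance

/-- `H^s(𝕋²)` carries its Borel σ-algebra. -/
instance (s : ℝ) : MeasurableSpace (Sobolev s) := borel _

instance (s : ℝ) : BorelSpace (Sobolev s) := ⟨rfl⟩

end Sobolev

/-- The phase space `ℋ^{-δ} = H^{-δ}(𝕋²) × H^{-δ-1}(𝕋²)` of the pairs `(z, y)`. -/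
abbrev Phase (δ : ℝ) : Type := Sobolev (-δ) × Sobolev (-δ - 1)

/-- The inclusion of `ℋ^{-δ}` in the space of pairs of distributions (sequences of Fourier
coefficients). -/
def Phase.coeffs {δ : ℝ} (x : Phase δ) : (Freq → ℂ) × (Freq → ℂ) := (x.1.coeff, x.2.coeff)

/-- The complex normal distribution `𝒩_c(0, r)`: the law of `X + iY` with `X`, `Y` independent real
Gaussian variables of mean `0` and variance `r / 2`. -/
def complexGaussian (r : ℝ≥0) : Measure ℂ :=
  ((gaussianReal 0 (r / 2)).prod (gaussianReal 0 (r / 2))).map fun p => (p.1 : ℂ) + Complex.I * p.2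

instance (r : ℝ≥0) : IsProbabilityMeasure (complexGaussian r) :=
  Measure.isProbabilityMeasure_map (by fun_prop)

/-- The Gaussian measure `⨂_k 𝒩_c(0, 2 (1 + |k|²)⁻¹) ⊗ ⨂_l 𝒩_c(0, 2)` on pairs of sequences of
Fourier coefficients. -/
def gaussianMeasure : Measure ((Freq → ℂ) × (Freq → ℂ)) :=
  (Measure.infinitePi fun k : Freq => complexGaussian (2 * (symb k)⁻¹)).prod
    (Measure.infinitePi fun _ : Freq => complexGaussian 2)

/-- The Gaussian measure as a measure on `ℋ^{-δ}`. -/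
def phaseMeasure (δ : ℝ) : Measure (Phase δ) := gaussianMeasure.comap Phase.coeffs

section Dynamics

variable {Ω : Type*} [mΩ : MeasurableSpace Ω]

/-- `β (k, 0)` and `β (k, 1)`, `k ∈ ℤ²`, are the coefficients `β_{k,R}` and `β_{k,I}` of a cylindrical
Wiener process on the stochastic basis `(Ω, P, ℱ)`: independent real Brownian motions that are
adapted to `ℱ` and whose increments after any time `s` are independent of `ℱ_s`. -/
structure IsCylindricalWiener (P : Measure Ω) (ℱ : Filtration ℝ≥0 mΩ)
    (β : Freq × Fin 2 → ℝ≥0 → Ω → ℝ) : Prop where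
  brownian : ∀ j, IsBrownianReal (β j) P
  indep : iIndepFun (fun j ω t => β j t ω) P
  adapted : ∀ j t, Measurable[ℱ t] (β j t)
  indep_past : ∀ s : ℝ≥0, Indep
    (MeasurableSpace.comap (fun ω (p : (Freq × Fin 2) × ℝ≥0) => β p.1 (s + p.2) ω - β p.1 s ω)
      inferInstance) (ℱ s) P

/-- The Fourier coefficients `Ŵ(t; k) = β_{k,R}(t) + i β_{k,I}(t)` of
`W(t) = ∑_k (β_{k,R}(t) + i β_{k,I}(t)) e_k`. -/
def noiseCoeff (β : Freq × Fin 2 → ℝ≥0 → Ω → ℝ) (t : ℝ≥0) (ω : Ω) (k : Freq) : ℂ :=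
  (β (k, 0) t ω : ℂ) + Complex.I * (β (k, 1) t ω : ℂ)

/-- `X = (Z, Y)` is a solution with paths in `C([0, ∞); ℋ^{-δ})` of the system
`dZ = ε⁻¹ Y dt`, `dY = ε⁻¹ (-2 α ε⁻¹ Y - (1 - Δ) Z) dt + 2 ε⁻¹ √(Re α) dW`,
that is, of `ε² ∂ₜ² Z + 2 α ∂ₜ Z + (1 - Δ) Z = 2 √(Re α) ∂ₜ W` with `Y = ε ∂ₜ Z`.
The two equations hold as identities of distributions on `𝕋²` in integrated form, which means for
all Fourier coefficients. Adaptedness is understood up to `P`-null sets. -/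
structure IsSolution (P : Measure Ω) (ℱ : Filtration ℝ≥0 mΩ) (β : Freq × Fin 2 → ℝ≥0 → Ω → ℝ)
    (ε : ℝ) (α : ℂ) (δ : ℝ) (X : ℝ≥0 → Ω → Phase δ) : Prop where
  adapted : ∀ t, ∃ g : Ω → Phase δ, Measurable[ℱ t] g ∧ X t =ᵐ[P] g
  continuous_paths : ∀ᵐ ω ∂P, Continuous fun t => X t ω
  eq_Z : ∀ᵐ ω ∂P, ∀ (t : ℝ≥0) (k : Freq),
    (X t ω).1.coeff k = (X 0 ω).1.coeff k
      + ∫ s in (0 : ℝ)..t, (ε : ℂ)⁻¹ * (X s.toNNReal ω).2.coeff k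
  eq_Y : ∀ᵐ ω ∂P, ∀ (t : ℝ≥0) (k : Freq),
    (X t ω).2.coeff k = (X 0 ω).2.coeff k
      + (∫ s in (0 : ℝ)..t, (ε : ℂ)⁻¹ *
          (-2 * α * (ε : ℂ)⁻¹ * (X s.toNNReal ω).2.coeff k
            - ((symb k : ℝ) : ℂ) * (X s.toNNReal ω).1.coeff k))
      + 2 * (ε : ℂ)⁻¹ * (Real.sqrt α.re : ℂ) * noiseCoeff β t ω k

/-- `Q` is the Markov transition semigroup of the process `(Z, Y)`: it is a semigroup of Markov
kernels on `ℋ^{-δ}`, and every solution `X` has the Markov property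
`P(X_{s+t} ∈ A | ℱ_s) = Q_t(X_s, A)`. -/
structure IsTransitionSemigroup (P : Measure Ω) (ℱ : Filtration ℝ≥0 mΩ)
    (β : Freq × Fin 2 → ℝ≥0 → Ω → ℝ) (ε : ℝ) (α : ℂ) (δ : ℝ)
    (Q : ℝ≥0 → Kernel (Phase δ) (Phase δ)) : Prop where
  isMarkovKernel : ∀ t, IsMarkovKernel (Q t)
  zero : Q 0 = Kernel.id
  add : ∀ s t, Q (s + t) = (Q t).comp (Q s)
  markov : ∀ X : ℝ≥0 → Ω → Phase δ, IsSolution P ℱ β ε α δ X →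
    ∀ (s t : ℝ≥0) (A : Set (Phase δ)), MeasurableSet A →
      P[(X (s + t) ⁻¹' A).indicator (fun _ => (1 : ℝ)) | ℱ s] =ᵐ[P] fun ω => (Q t (X s ω)).real A

end Dynamics

end KleinGordon

end

/-! In Fourier coefficients the system decouples into equations dx = A x dt + B dw on ℂ², one for
each symbol m = 1 + |k|², driven by independent planar Brownian motions. Two structures of a single
mode carry the proof.

Dissipation: along the flow e^{tA} the energy E(x) = m|z|² + |y|² decreases at the rate (4 Re
α/ε²)|y|² (`hasDerivAt_energy_flow`).

Symmetry: A is symmetric for the complex bilinear form b(x, x') = -m z z' + y y', so e^{tA} equals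
its own transpose (`pairing_flow`). Hence Re b(θ, N), for the stochastic convolution N = ∫₀ᵗ
e^{(t-s)A} B dw(s), is a Wiener integral with variance ∫₀ᵗ (4 Re α/ε²)|(e^{sA}θ)₂|² ds, which by the
energy balance is E(θ) - E(e^{tA}θ). The Gaussian measure of the mode has characteristic function
exp(-E(θ)/2) at Re b(θ, ·). If ξ has this law and is independent of N, then e^{tA}ξ + N has
characteristic function exp(-E(e^{tA}θ)/2) exp(-(E(θ) - E(e^{tA}θ))/2) = exp(-E(θ)/2). This is
invariance for one mode (`IsPlanarBrownian.map_modeMeasure_prod`); independence of the modes gives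
it for the product.

No stochastic integration is needed. As e^{(t-s)A} is smooth in s, N is a pathwise limit of
Riemann–Stieltjes sums, thus a measurable function of the noise up to time t.

For paths in ℋ^{-δ} one needs a bound of E(N) locally uniform in time and summable over the modes
with weight m^{-δ-1}. Since e^{tA} contracts the energy, √E(N) at time s + h is at most its value at
s plus √E of the convolution with the increments after s. Dyadic chaining with fourth moments
(`energy_stochConv_le`, `IsPlanarBrownian.lintegral_dyadicSum_le`) gives a bound in expectation
uniform in m, and ∑ m^{-δ-1} is finite in dimension two. Continuity then follows from continuity of
each coefficient by dominated convergence.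

The equation determines each mode path by path, so every solution restarts at time s from X(s) with
the noise increments after s (`IsSolution.ae_eq_step`). These are independent of the past and have
the law of the noise, which yields the Markov property and the Chapman–Kolmogorov equations. -/

noncomputable section

namespace KleinGordon

open Filter Topology Finset

/-! ### Linear equations with additive continuous forcing -/

section Abstract

variable {E V : Type*} [NormedAddCommGroup E] [NormedSpace ℝ E] [NormedAddCommGroup V]
  [NormedSpace ℝ V] [CompleteSpace V] (A : V →L[ℝ] V) (B : E →L[ℝ] V)

/-- The group `t ↦ e^{tA}` generated by `A`. -/
def expFlow (t : ℝ) : V →L[ℝ] V := NormedSpace.exp (t • A)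

omit [CompleteSpace V] in
lemma expFlow_zero : expFlow A 0 = 1 := by simp [expFlow]

lemma expFlow_add (s t : ℝ) : expFlow A (s + t) = expFlow A s * expFlow A t := by
  let _ := NormedAlgebra.restrictScalars ℚ ℝ (V →L[ℝ] V)
  unfold expFlow
  rw [add_smul]
  exact NormedSpace.exp_add_of_commute (((Commute.refl _).smul_left s).smul_right t)

omit [CompleteSpace V] in
lemma expFlow_zero_apply (x : V) : expFlow A 0 x = x := by rw [expFlow_zero]; rfl

lemma expFlow_add_apply (s t : ℝ) (x : V) :
    expFlow A (s + t) x = expFlow A s (expFlow A t x) := by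
  rw [expFlow_add]; rfl

lemma hasDerivAt_expFlow (t : ℝ) : HasDerivAt (expFlow A) (A * expFlow A t) t :=
  hasDerivAt_exp_smul_const' A t

lemma hasDerivAt_expFlow' (t : ℝ) : HasDerivAt (expFlow A) (expFlow A t * A) t :=
  hasDerivAt_exp_smul_const A t

lemma continuous_expFlow : Continuous (expFlow A) :=
  continuous_iff_continuousAt.2 fun t => (hasDerivAt_expFlow A t).continuousAt

lemma hasDerivAt_expFlow_apply (x : V) (t : ℝ) :
    HasDerivAt (fun t => expFlow A t x) (A (expFlow A t x)) t := by
  simpa using (hasDerivAt_expFlow A t).clm_apply (hasDerivAt_const t x)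

lemma continuous_expFlow_apply {X : Type*} [TopologicalSpace X] {t : X → ℝ} {x : X → V}
    (ht : Continuous t) (hx : Continuous x) : Continuous fun a => expFlow A (t a) (x a) :=
  ((continuous_expFlow A).comp ht).clm_apply hx

/-- The solution with zero initial value of `dx = A x dt + B dw`, for a continuous path `w`. -/
def duhamel (w : ℝ → E) (t : ℝ) : V :=
  B (w t) + expFlow A t (∫ s in (0 : ℝ)..t, expFlow A (-s) (A (B (w s))))

variable {w : ℝ → E}

lemma continuous_duhamel_integrand (hw : Continuous w) :
    Continuous fun s => expFlow A (-s) (A (B (w s))) :=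
  continuous_expFlow_apply A continuous_neg (by fun_prop)

/-- Although `w` need not be differentiable, x - B w is: it solves v' = A (v + B w), an equation
with continuous forcing. -/
lemma hasDerivAt_expFlow_integral (hw : Continuous w) (t : ℝ) : HasDerivAt
    (fun t => expFlow A t (∫ s in (0 : ℝ)..t, expFlow A (-s) (A (B (w s)))))
    (A (duhamel A B w t)) t := by
  have hc := continuous_duhamel_integrand A B hw
  have h1 := intervalIntegral.integral_hasDerivAt_right (hc.intervalIntegrable 0 t)
    (hc.stronglyMeasurableAtFilter _ _) hc.continuousAt
  refine ((hasDerivAt_expFlow A t).clm_apply h1).congr_deriv ?_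
  have : expFlow A t (expFlow A (-t) (A (B (w t)))) = A (B (w t)) := by
    rw [← expFlow_add_apply, add_neg_cancel, expFlow_zero_apply]
  rw [this, duhamel, map_add, add_comm]
  rfl

lemma continuous_duhamel (hw : Continuous w) : Continuous (duhamel A B w) :=
  (B.continuous.comp hw).add
    (continuous_iff_continuousAt.2 fun t => (hasDerivAt_expFlow_integral A B hw t).continuousAt)

/-- The Duhamel formula solves the integrated equation. -/
lemma duhamel_eq_integral (hw : Continuous w) (t : ℝ) :
    duhamel A B w t = (∫ s in (0 : ℝ)..t, A (duhamel A B w s)) + B (w t) := by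
  rw [intervalIntegral.integral_eq_sub_of_hasDerivAt
    (fun s _ => hasDerivAt_expFlow_integral A B hw s)
    ((A.continuous.comp (continuous_duhamel A B hw)).intervalIntegrable _ _)]
  simp [duhamel, add_comm]

lemma expFlow_eq_integral (x : V) (t : ℝ) :
    expFlow A t x = x + ∫ s in (0 : ℝ)..t, A (expFlow A s x) := by
  rw [intervalIntegral.integral_eq_sub_of_hasDerivAt
    (fun s _ => hasDerivAt_expFlow_apply A x s)
    ((A.continuous.comp
      (continuous_expFlow_apply A continuous_id continuous_const)).intervalIntegrable _ _)]
  simp [expFlow_zero_apply]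

/-- Every solution of the integrated equation is given by the Duhamel formula. -/
lemma eq_expFlow_add_duhamel (hw : Continuous w) {x : ℝ → V} (hx : Continuous x) {x₀ : V}
    (h : ∀ t, 0 ≤ t → x t = x₀ + (∫ s in (0 : ℝ)..t, A (x s)) + B (w t))
    {t : ℝ} (ht : 0 ≤ t) : x t = expFlow A t x₀ + duhamel A B w t := by
  have hg : Continuous fun s => A (x s) := by fun_prop
  have hy : ∀ s, HasDerivAt (fun t => x₀ + ∫ s in (0 : ℝ)..t, A (x s)) (A (x s)) s := fun s =>
    (intervalIntegral.integral_hasDerivAt_right (hg.intervalIntegrable 0 s)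
      (hg.stronglyMeasurableAtFilter _ _) hg.continuousAt).const_add x₀
  have hR : ∀ s, HasDerivAt (fun t => expFlow A (-t)) (-(expFlow A (-s) * A)) s := fun s => by
    simpa [Function.comp_def] using (hasDerivAt_expFlow' A (-s)).scomp s (hasDerivAt_neg s)
  -- Variation of constants for x - B w, which by the equation is x₀ + ∫ A x at nonnegative times.
  have hd : ∀ s ∈ Set.uIcc 0 t, HasDerivAt
      (fun t => expFlow A (-t) (x₀ + ∫ s in (0 : ℝ)..t, A (x s)))
      (expFlow A (-s) (A (B (w s)))) s := by
    intro s hs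
    rw [Set.uIcc_of_le ht] at hs
    refine ((hR s).clm_apply (hy s)).congr_deriv ?_
    have e : (-(expFlow A (-s) * A)) (x₀ + ∫ s in (0 : ℝ)..s, A (x s))
      = - expFlow A (-s) (A (x₀ + ∫ s in (0 : ℝ)..s, A (x s))) := rfl
    rw [e, neg_add_eq_sub, ← map_sub, ← map_sub]
    congr 2
    rw [sub_eq_iff_eq_add, add_comm]
    exact h s hs.1
  have hI := intervalIntegral.integral_eq_sub_of_hasDerivAt hd
    ((continuous_duhamel_integrand A B hw).intervalIntegrable _ _)
  rw [duhamel, hI, h t ht]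
  simp only [neg_zero, expFlow_zero_apply, intervalIntegral.integral_same, add_zero, map_sub]
  rw [← expFlow_add_apply, add_neg_cancel, expFlow_zero_apply]
  abel

/-- The Riemann–Stieltjes sum with `n` steps for `∫₀ᵗ e^{(t-s)A} B dw(s)`. -/
def stieltjesSum (t : ℝ≥0) (w : ℝ≥0 → E) (n : ℕ) : V :=
  ∑ i ∈ range n, expFlow A (t - t * (i / n) : ℝ)
    (B (w (t * ((i + 1 : ℕ) / n)) - w (t * (i / n))))

/-- Summation by parts. -/
lemma stieltjesSum_eq (t : ℝ≥0) (w : ℝ≥0 → E) (hw : w 0 = 0) {n : ℕ} (hn : n ≠ 0) :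
    stieltjesSum A B t w n = B (w t) + ∑ i ∈ range n,
      ∫ s in (t * (i / n) : ℝ)..(t * ((i + 1 : ℕ) / n) : ℝ),
        expFlow A (t - s) (A (B (w (t * ((i + 1 : ℕ) / n))))) := by
  have hn' : (n : ℝ≥0) ≠ 0 := by exact_mod_cast hn
  -- Telescoping yields the boundary term `B (w t)`. What remains of each summand is an increment of
  -- s ↦ e^{(t-s)A}, applied to the right endpoint value of `B w`.
  have h := Finset.sum_range_sub
    (fun i => expFlow A (t - t * (i / n) : ℝ) (B (w (t * (i / n))))) n
  simp only [CharP.cast_eq_zero, zero_div, mul_zero, hw, map_zero, sub_zero, div_self hn', mul_one,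
    div_self (show (n : ℝ) ≠ 0 by exact_mod_cast hn), sub_self, expFlow_zero_apply] at h
  rw [← h, stieltjesSum, ← Finset.sum_add_distrib]
  refine Finset.sum_congr rfl fun i _ => ?_
  set y := B (w (t * ((i + 1 : ℕ) / n)))
  have hd : ∀ s : ℝ, HasDerivAt (fun s : ℝ => -expFlow A (t - s) y) (expFlow A (t - s) (A y)) s := by
    intro s
    have := ((hasDerivAt_expFlow' A (t - s)).scomp s ((hasDerivAt_id s).const_sub (t : ℝ))).clm_apply
      (hasDerivAt_const s y)
    refine this.neg.congr_deriv ?_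
    simp
  rw [intervalIntegral.integral_eq_sub_of_hasDerivAt (fun s _ => hd s)
    ((continuous_expFlow_apply A (by fun_prop) continuous_const).intervalIntegrable _ _), map_sub,
    map_sub]
  abel

-- Uniform continuity of `w` and boundedness of `G` on [0, t]. It serves twice: for the Stieltjes
-- sums after summation by parts, and with `G` the identity for their variances.
omit [CompleteSpace V] in
lemma tendsto_sum_integral {G : ℝ → E →L[ℝ] V} (hG : Continuous G) {w : ℝ≥0 → E}
    (hw : Continuous w) (t : ℝ≥0) :
    Tendsto (fun n : ℕ => ∑ i ∈ range n, ∫ s in (t * (i / n) : ℝ)..(t * ((i + 1 : ℕ) / n) : ℝ),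
        G s (w (t * ((i + 1 : ℕ) / n)))) atTop (𝓝 (∫ s in (0 : ℝ)..t, G s (w s.toNNReal))) := by
  obtain ⟨C, hC⟩ := isCompact_Icc.exists_bound_of_continuousOn (s := Set.Icc (0 : ℝ) t)
    hG.continuousOn
  have hC0 : 0 ≤ C := (norm_nonneg _).trans (hC 0 ⟨le_rfl, t.2⟩)
  have hw' : Continuous fun s : ℝ => w s.toNNReal := hw.comp continuous_real_toNNReal
  have hu := isCompact_Icc.uniformContinuousOn_of_continuous (s := Set.Icc (0 : ℝ) t)
    hw'.continuousOn
  rw [Metric.uniformContinuousOn_iff] at hu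
  rw [Metric.tendsto_atTop]
  intro η hη
  -- The total error is at most C t times this tolerance, which is less than η; the 1 covers the
  -- case C t = 0.
  obtain ⟨d, hd, hu⟩ := hu (η / (C * t + 1)) (by positivity)
  obtain ⟨N, hN⟩ := exists_nat_gt ((t : ℝ) / d)
  refine ⟨N + 1, fun n hn => ?_⟩
  have hn0 : (0 : ℝ) < n := by exact_mod_cast (by omega : 0 < n)
  have hstep : (t : ℝ) / n < d := by
    rw [div_lt_iff₀ hn0]
    rw [div_lt_iff₀ hd] at hN
    have : (N : ℝ) ≤ n := by exact_mod_cast (by omega : N ≤ n)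
    nlinarith
  have hcont : Continuous fun s => G s (w s.toNNReal) := hG.clm_apply hw'
  have hsplit : ∫ s in (0 : ℝ)..t, G s (w s.toNNReal)
      = ∑ i ∈ range n, ∫ s in (t * (i / n) : ℝ)..(t * ((i + 1 : ℕ) / n) : ℝ),
        G s (w s.toNNReal) := by
    rw [intervalIntegral.sum_integral_adjacent_intervals (a := fun i : ℕ => (t * (i / n) : ℝ))
      fun k _ => hcont.intervalIntegrable _ _]
    simp [div_self hn0.ne']
  rw [hsplit, dist_eq_norm, ← Finset.sum_sub_distrib]
  have hterm : ∀ i ∈ range n, ‖(∫ s in (t * (i / n) : ℝ)..(t * ((i + 1 : ℕ) / n) : ℝ),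
        G s (w (t * ((i + 1 : ℕ) / n)))) - ∫ s in (t * (i / n) : ℝ)..(t * ((i + 1 : ℕ) / n) : ℝ),
        G s (w s.toNNReal)‖ ≤ C * (η / (C * t + 1)) * (t / n) := by
    intro i hi
    have hi' : ((i : ℝ) + 1) ≤ n := by exact_mod_cast Finset.mem_range.1 hi
    rw [← intervalIntegral.integral_sub
      ((hG.clm_apply continuous_const).intervalIntegrable _ _) (hcont.intervalIntegrable _ _)]
    have hle : (t * (i / n) : ℝ) ≤ t * ((i + 1 : ℕ) / n) := by
      push_cast; gcongr; linarith
    have hlast : (t * ((i + 1 : ℕ) / n) : ℝ) ≤ t := by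
      push_cast
      exact mul_le_of_le_one_right t.2 ((div_le_one hn0).2 hi')
    have hlen : (t * ((i + 1 : ℕ) / n) : ℝ) - t * (i / n) = t / n := by
      push_cast; ring
    refine (intervalIntegral.norm_integral_le_of_norm_le_const
      (C := C * (η / (C * t + 1))) fun s hs => ?_).trans ?_
    · rw [Set.uIoc_of_le hle] at hs
      have hs0 : 0 ≤ s := (by positivity : (0 : ℝ) ≤ t * (i / n)).trans hs.1.le
      rw [← map_sub]
      refine ((G s).le_opNorm _).trans (mul_le_mul (hC s ⟨hs0, hs.2.trans hlast⟩) ?_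
        (norm_nonneg _) hC0)
      have := hu (t * ((i + 1 : ℕ) / n)) ⟨by positivity, hlast⟩ s ⟨hs0, hs.2.trans hlast⟩ (by
        rw [Real.dist_eq, abs_of_nonneg (by linarith [hs.2])]
        linarith [hs.1])
      rw [dist_eq_norm] at this
      have e : ((t : ℝ) * ((i + 1 : ℕ) / n)).toNNReal = t * ((i + 1 : ℕ) / n) := by
        rw [← Real.toNNReal_coe (r := t * ((i + 1 : ℕ) / n))]; norm_cast
      rw [e] at this
      exact this.le
    · rw [hlen, abs_of_nonneg (by positivity)]
  refine (norm_sum_le_of_le _ hterm).trans_lt ?_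
  rw [Finset.sum_const, card_range, nsmul_eq_mul]
  have e : (n : ℝ) * (C * (η / (C * t + 1)) * (t / n)) = η * ((C * t) / (C * t + 1)) := by
    field_simp
  rw [e]
  have : (C * t) / (C * t + 1) < 1 := by
    rw [div_lt_one (by positivity)]; linarith
  nlinarith

lemma tendsto_stieltjesSum {w : ℝ≥0 → E} (hw : Continuous w) (hw0 : w 0 = 0) (t : ℝ≥0) :
    Tendsto (stieltjesSum A B t w) atTop (𝓝 (duhamel A B (fun s => w s.toNNReal) t)) := by
  have hG : Continuous fun s : ℝ => (expFlow A (t - s) * A).comp B := by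
    have := (continuous_expFlow A).comp (continuous_sub_left (t : ℝ))
    exact (this.mul continuous_const).clm_comp continuous_const
  have h := (tendsto_sum_integral hG hw t).const_add (B (w t))
  have e : duhamel A B (fun s => w s.toNNReal) t
      = B (w t) + ∫ s in (0 : ℝ)..t, (expFlow A (t - s) * A).comp B (w s.toNNReal) := by
    have hc : Continuous fun s : ℝ => expFlow A (-s) (A (B (w s.toNNReal))) :=
      continuous_duhamel_integrand A B (hw.comp continuous_real_toNNReal)
    rw [duhamel, Real.toNNReal_coe,
      ← ContinuousLinearMap.intervalIntegral_comp_comm _ (hc.intervalIntegrable _ _)]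
    congr 1
    refine intervalIntegral.integral_congr fun s _ => ?_
    simp only [← expFlow_add_apply, ← sub_eq_add_neg]
    rfl
  rw [e]
  refine h.congr' ?_
  filter_upwards [eventually_ne_atTop 0] with n hn
  rw [stieltjesSum_eq A B t w hw0 hn]
  rfl

end Abstract

/-! ### Energy and symmetry of a single Fourier mode -/

section Mode

variable (ε : ℝ) (α : ℂ) (m : ℝ)

/-- The generator of the damped Klein–Gordon flow on a Fourier mode with symbol `m`. -/
def gen : ℂ × ℂ →L[ℝ] ℂ × ℂ :=
  ((ContinuousLinearMap.mul ℝ ℂ (ε : ℂ)⁻¹).comp (ContinuousLinearMap.snd ℝ ℂ ℂ)).prod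
    ((ContinuousLinearMap.mul ℝ ℂ (ε : ℂ)⁻¹).comp
      ((ContinuousLinearMap.mul ℝ ℂ (-2 * α * (ε : ℂ)⁻¹)).comp (ContinuousLinearMap.snd ℝ ℂ ℂ)
        - (ContinuousLinearMap.mul ℝ ℂ (m : ℂ)).comp (ContinuousLinearMap.fst ℝ ℂ ℂ)))

/-- The way in which the noise enters the system. -/
def noiseDir : ℂ →L[ℝ] ℂ × ℂ :=
  (0 : ℂ →L[ℝ] ℂ).prod (ContinuousLinearMap.mul ℝ ℂ (2 * (ε : ℂ)⁻¹ * (Real.sqrt α.re : ℂ)))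

/-- The flow of the deterministic damped Klein–Gordon equation on a Fourier mode. -/
def flow (t : ℝ) : ℂ × ℂ →L[ℝ] ℂ × ℂ := expFlow (gen ε α m) t

/-- The energy of a Fourier mode with symbol `m`. -/
def energy (m : ℝ) (x : ℂ × ℂ) : ℝ := m * ‖x.1‖ ^ 2 + ‖x.2‖ ^ 2

/-- The bilinear form for which the generator is symmetric. -/
def pairing (m : ℝ) (x y : ℂ × ℂ) : ℂ := -(m : ℂ) * x.1 * y.1 + x.2 * y.2

lemma gen_apply (x : ℂ × ℂ) : gen ε α m x =
    ((ε : ℂ)⁻¹ * x.2, (ε : ℂ)⁻¹ * (-2 * α * (ε : ℂ)⁻¹ * x.2 - (m : ℂ) * x.1)) := by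
  simp [gen]
  ring

lemma noiseDir_apply (c : ℂ) :
    noiseDir ε α c = (0, 2 * (ε : ℂ)⁻¹ * (Real.sqrt α.re : ℂ) * c) := by
  simp [noiseDir]

lemma hasDerivAt_flow_fst (x : ℂ × ℂ) (t : ℝ) :
    HasDerivAt (fun t => (flow ε α m t x).1) (gen ε α m (flow ε α m t x)).1 t :=
  (ContinuousLinearMap.fst ℝ ℂ ℂ).hasFDerivAt.comp_hasDerivAt t
    (hasDerivAt_expFlow_apply (gen ε α m) x t)

lemma hasDerivAt_flow_snd (x : ℂ × ℂ) (t : ℝ) :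
    HasDerivAt (fun t => (flow ε α m t x).2) (gen ε α m (flow ε α m t x)).2 t :=
  (ContinuousLinearMap.snd ℝ ℂ ℂ).hasFDerivAt.comp_hasDerivAt t
    (hasDerivAt_expFlow_apply (gen ε α m) x t)

/-- The form is bilinear, not sesquilinear, so multiplication by a complex α is symmetric; the sign
of -m makes the two coupling terms swap. -/
lemma pairing_gen (x y : ℂ × ℂ) :
    pairing m (gen ε α m x) y = pairing m x (gen ε α m y) := by
  simp only [pairing, gen_apply]; ring

/-- By symmetry of the generator, b(e^{(t-s)A}x, e^{sA}y) does not depend on s; compare s = 0 and s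
= t. -/
lemma pairing_flow (t : ℝ) (x y : ℂ × ℂ) :
    pairing m (flow ε α m t x) y = pairing m x (flow ε α m t y) := by
  have key : ∀ s, HasDerivAt
      (fun s => pairing m (flow ε α m (t - s) x) (flow ε α m s y)) 0 s := by
    intro s
    have hts : HasDerivAt (fun s => t - s) (-1) s := (hasDerivAt_id s).const_sub t
    have h := ((((hasDerivAt_flow_fst ε α m x (t - s)).scomp s hts).const_mul (-(m : ℂ))).mul
      (hasDerivAt_flow_fst ε α m y s)).add
      (((hasDerivAt_flow_snd ε α m x (t - s)).scomp s hts).mul (hasDerivAt_flow_snd ε α m y s))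
    refine h.congr_deriv ?_
    have := pairing_gen ε α m (flow ε α m (t - s) x) (flow ε α m s y)
    simp only [pairing] at this
    simp only [neg_smul, one_smul, Function.comp_apply]
    linear_combination -this
  have := is_const_of_deriv_eq_zero (fun s => (key s).differentiableAt)
    (fun s => (key s).deriv) 0 t
  simpa [flow, expFlow_zero_apply] using this

variable {ε α m}

/-- The coupling terms cancel and Im α only rotates y, so the damping Re α alone does work. -/
lemma hasDerivAt_energy_flow (hε : ε ≠ 0) (x : ℂ × ℂ) (t : ℝ) :
    HasDerivAt (fun t => energy m (flow ε α m t x))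
      (-(4 * α.re / ε ^ 2 * ‖(flow ε α m t x).2‖ ^ 2)) t := by
  have h1 := ((hasDerivAt_flow_fst ε α m x t).norm_sq.const_mul m).add
    (hasDerivAt_flow_snd ε α m x t).norm_sq
  refine h1.congr_deriv ?_
  set y := flow ε α m t x
  simp only [gen_apply, Complex.inner, ← Complex.ofReal_inv]
  simp only [← Complex.normSq_eq_norm_sq, Complex.normSq_apply, Complex.mul_re, Complex.mul_im,
    Complex.sub_re, Complex.sub_im, Complex.conj_re, Complex.conj_im, Complex.ofReal_re,
    Complex.ofReal_im, Complex.neg_re, Complex.neg_im, Complex.re_ofNat, Complex.im_ofNat]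
  field_simp
  ring

lemma energy_nonneg (hm : 0 ≤ m) (x : ℂ × ℂ) : 0 ≤ energy m x := by
  unfold energy; positivity

lemma continuous_energy (m : ℝ) : Continuous (energy m) := by
  unfold energy; fun_prop

lemma energy_flow_le (hε : ε ≠ 0) (hα : 0 ≤ α.re) {t : ℝ} (ht : 0 ≤ t) (x : ℂ × ℂ) :
    energy m (flow ε α m t x) ≤ energy m x := by
  have h : Antitone fun t => energy m (flow ε α m t x) :=
    antitone_of_hasDerivAt_nonpos (fun t => hasDerivAt_energy_flow hε x t)
      fun t => neg_nonpos.2 (by simp only; positivity)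
  simpa [flow, expFlow_zero_apply] using h ht

lemma continuous_flow_snd (x : ℂ × ℂ) : Continuous fun s => (flow ε α m s x).2 :=
  (continuous_expFlow_apply (gen ε α m) continuous_id continuous_const).snd

/-- Fluctuation and dissipation: the integrand is also the rate at which the noise adds variance, so
variances of the convolution become energy differences. -/
lemma integral_norm_sq_flow (hε : ε ≠ 0) (x : ℂ × ℂ) (t : ℝ) :
    ∫ s in (0 : ℝ)..t, 4 * α.re / ε ^ 2 * ‖(flow ε α m s x).2‖ ^ 2
      = energy m x - energy m (flow ε α m t x) := by
  have hc : Continuous fun s => -(4 * α.re / ε ^ 2 * ‖(flow ε α m s x).2‖ ^ 2) :=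
    (continuous_const.mul ((continuous_flow_snd x).norm.pow 2)).neg
  have h := intervalIntegral.integral_eq_sub_of_hasDerivAt (a := 0) (b := t)
    (fun s _ => hasDerivAt_energy_flow (m := m) (α := α) hε x s) (hc.intervalIntegrable _ _)
  rw [intervalIntegral.integral_neg] at h
  simp only [flow, expFlow_zero_apply] at h ⊢
  linarith

lemma sqrt_energy_add_le (hm : 0 ≤ m) (x y : ℂ × ℂ) :
    Real.sqrt (energy m (x + y)) ≤ Real.sqrt (energy m x) + Real.sqrt (energy m y) := by
  have key : ∀ x : ℂ × ℂ, Real.sqrt (energy m x)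
      = ‖WithLp.toLp 2 ((Real.sqrt m : ℂ) * x.1, x.2)‖ := by
    intro x
    rw [WithLp.prod_norm_eq_of_L2]
    simp [energy, mul_pow, Real.sq_sqrt hm]
  rw [key, key, key]
  refine le_trans (le_of_eq ?_) (norm_add_le _ _)
  rw [← WithLp.toLp_add]
  simp [mul_add]

end Mode

/-! ### The stochastic convolution, path by path -/

section StochConv

variable (ε : ℝ) (α : ℂ) (m : ℝ)

/-- The stochastic convolution `∫₀ᵗ e^{(t-s)A} B dw(s)` on a Fourier mode, as a function of the
path `w`. -/
def stochConv (t : ℝ≥0) (w : ℝ≥0 → ℂ) : ℂ × ℂ :=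
  limUnder atTop (stieltjesSum (gen ε α m) (noiseDir ε α) t w)

/-- The increments of a path after the time `s`. -/
def shiftPath {E : Type*} [Sub E] (s : ℝ≥0) (w : ℝ≥0 → E) (t : ℝ≥0) : E := w (s + t) - w s

lemma stochConv_zero (w : ℝ≥0 → ℂ) : stochConv ε α m 0 w = 0 := by
  have : stieltjesSum (gen ε α m) (noiseDir ε α) 0 w = fun _ => 0 := by
    ext n : 1
    simp [stieltjesSum]
  rw [stochConv, this]
  exact tendsto_const_nhds.limUnder_eq

/-- The sums use only values of the path up to time t, so with the σ-algebra `ℱ t` on `S` this gives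
adaptedness. Paths along which the sums diverge do no harm, as `limUnder` stays measurable there. -/
lemma measurable_stochConv {S : Type*} [MeasurableSpace S] {t : ℝ≥0} {W : S → ℝ≥0 → ℂ}
    (hW : ∀ s ≤ t, Measurable fun a => W a s) :
    Measurable fun a => stochConv ε α m t (W a) := by
  refine (StronglyMeasurable.limUnder (l := atTop)
    (f := fun (n : ℕ) a => stieltjesSum (gen ε α m) (noiseDir ε α) t (W a) n)
    fun n => Measurable.stronglyMeasurable ?_).measurable
  unfold stieltjesSum
  refine Finset.measurable_fun_sum _ fun i hi => ?_
  have hi' : i + 1 ≤ n := Finset.mem_range.1 hi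
  have hn : (0 : ℝ≥0) < n := by exact_mod_cast (by omega : 0 < n)
  have h : ∀ j : ℕ, j ≤ n → t * ((j : ℝ≥0) / n) ≤ t := fun j hj =>
    mul_le_of_le_one_right zero_le ((div_le_one hn).2 (by exact_mod_cast hj))
  exact (ContinuousLinearMap.measurable _).comp ((noiseDir ε α).measurable.comp
    ((hW _ (h _ hi')).sub (hW _ (h _ (by omega)))))

variable {w : ℝ≥0 → ℂ}

lemma tendsto_stochConv (hw : Continuous w) (hw0 : w 0 = 0) (t : ℝ≥0) :
    Tendsto (stieltjesSum (gen ε α m) (noiseDir ε α) t w) atTop (𝓝 (stochConv ε α m t w)) :=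
  tendsto_nhds_limUnder ⟨_, tendsto_stieltjesSum _ _ hw hw0 t⟩

lemma stochConv_eq (hw : Continuous w) (hw0 : w 0 = 0) (t : ℝ≥0) :
    stochConv ε α m t w = duhamel (gen ε α m) (noiseDir ε α) (fun s => w s.toNNReal) t :=
  (tendsto_stieltjesSum _ _ hw hw0 t).limUnder_eq

lemma continuous_stochConv (hw : Continuous w) (hw0 : w 0 = 0) :
    Continuous fun t => stochConv ε α m t w := by
  simp only [stochConv_eq ε α m hw hw0]
  exact (continuous_duhamel _ _ (hw.comp continuous_real_toNNReal)).comp NNReal.continuous_coe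

lemma continuous_shiftPath (hw : Continuous w) (s : ℝ≥0) : Continuous (shiftPath s w) := by
  unfold shiftPath; fun_prop

lemma shiftPath_zero (s : ℝ≥0) : shiftPath s w 0 = 0 := by simp [shiftPath]

/-- Every solution of the integrated equation is given by the flow and the stochastic
convolution. -/
lemma eq_flow_add_stochConv (hw : Continuous w) (hw0 : w 0 = 0) {x : ℝ → ℂ × ℂ}
    (hx : Continuous x) {x₀ : ℂ × ℂ}
    (h : ∀ t : ℝ≥0, x t = x₀ + (∫ s in (0 : ℝ)..t, gen ε α m (x s)) + noiseDir ε α (w t))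
    (t : ℝ≥0) : x t = flow ε α m t x₀ + stochConv ε α m t w := by
  rw [stochConv_eq ε α m hw hw0]
  refine eq_expFlow_add_duhamel _ _ (hw.comp continuous_real_toNNReal) hx (fun s hs => ?_) t.2
  lift s to ℝ≥0 using hs
  simpa using h s

lemma flow_add_stochConv_eq_integral (hw : Continuous w) (hw0 : w 0 = 0) (x₀ : ℂ × ℂ) (t : ℝ≥0) :
    flow ε α m t x₀ + stochConv ε α m t w = x₀ +
      (∫ s in (0 : ℝ)..t, gen ε α m (flow ε α m s.toNNReal x₀ + stochConv ε α m s.toNNReal w))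
        + noiseDir ε α (w t) := by
  have hw' : Continuous fun s : ℝ => w s.toNNReal := hw.comp continuous_real_toNNReal
  have e : (∫ s in (0 : ℝ)..t,
      gen ε α m (flow ε α m s.toNNReal x₀ + stochConv ε α m s.toNNReal w))
      = (∫ s in (0 : ℝ)..t, gen ε α m (flow ε α m s x₀))
        + ∫ s in (0 : ℝ)..t, gen ε α m
          (duhamel (gen ε α m) (noiseDir ε α) (fun s => w s.toNNReal) s) := by
    rw [← intervalIntegral.integral_add]
    · refine intervalIntegral.integral_congr fun s hs => ?_
      rw [Set.uIcc_of_le t.coe_nonneg] at hs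
      simp only [stochConv_eq ε α m hw hw0, Real.coe_toNNReal s hs.1, map_add]
    · exact ((gen ε α m).continuous.comp
        (continuous_expFlow_apply (gen ε α m) continuous_id continuous_const)).intervalIntegrable _ _
    · exact ((gen ε α m).continuous.comp (continuous_duhamel _ _ hw')).intervalIntegrable _ _
  rw [e, stochConv_eq ε α m hw hw0, duhamel_eq_integral _ _ hw']
  have h1 := expFlow_eq_integral (gen ε α m) x₀ t
  unfold flow
  rw [h1, Real.toNNReal_coe]
  abel

/-- The equation restarted at the time `s`. -/
lemma restart_eq_flow_add_stochConv (hw : Continuous w) {x : ℝ≥0 → ℂ × ℂ}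
    (hx : Continuous x) {x₀ : ℂ × ℂ} (h : ∀ t : ℝ≥0, x t = x₀
      + (∫ s in (0 : ℝ)..t, gen ε α m (x s.toNNReal)) + noiseDir ε α (w t)) (s t : ℝ≥0) :
    x (s + t) = flow ε α m t (x s) + stochConv ε α m t (shiftPath s w) := by
  have hg : Continuous fun u : ℝ => gen ε α m (x u.toNNReal) :=
    (gen ε α m).continuous.comp (hx.comp continuous_real_toNNReal)
  have key := eq_flow_add_stochConv ε α m (continuous_shiftPath hw s) (shiftPath_zero s)
    (x := fun u => x (s + u.toNNReal)) (x₀ := x s) (by fun_prop) (fun u => ?_) t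
  · simpa using key
  · rw [Real.toNNReal_coe, h (s + u), h s, shiftPath, map_sub]
    have e : ∫ v in (0 : ℝ)..u, gen ε α m (x (s + v.toNNReal))
        = ∫ v in (s : ℝ)..(s + u : ℝ≥0), gen ε α m (x v.toNNReal) := by
      have := intervalIntegral.integral_comp_add_left (a := 0) (b := u)
        (fun v : ℝ => gen ε α m (x v.toNNReal)) (s : ℝ)
      rw [add_zero, ← NNReal.coe_add] at this
      rw [← this]
      refine intervalIntegral.integral_congr fun v hv => ?_
      rw [Set.uIcc_of_le u.coe_nonneg] at hv
      simp only [Real.toNNReal_add s.coe_nonneg hv.1, Real.toNNReal_coe]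
    rw [e, ← intervalIntegral.integral_add_adjacent_intervals
      (hg.intervalIntegrable 0 (s : ℝ)) (hg.intervalIntegrable _ _)]
    abel

/-- The convolution solves the equation from 0, so it can be restarted at time s. The chaining
inequality rests on this identity. -/
lemma stochConv_add (hw : Continuous w) (hw0 : w 0 = 0) (s t : ℝ≥0) :
    stochConv ε α m (s + t) w
      = flow ε α m t (stochConv ε α m s w) + stochConv ε α m t (shiftPath s w) := by
  refine restart_eq_flow_add_stochConv ε α m hw (x := fun t => stochConv ε α m t w)
    (x₀ := 0) (continuous_stochConv ε α m hw hw0) (fun t => ?_) s t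
  simpa using flow_add_stochConv_eq_integral ε α m hw hw0 0 t

end StochConv

/-! ### Dyadic chaining in the energy norm -/

section Chaining

/-- The chaining bound on the dyadic points of `[0, T]`. -/
lemma le_sum_of_dyadic_increments {r : ℝ≥0 → ℝ} {p : ℝ≥0 → ℝ≥0 → ℝ} {a : ℕ → ℝ} {T : ℝ≥0}
    (h0 : r 0 = 0) (hr : ∀ s h, r (s + h) ≤ r s + p s h) (ha : ∀ l, 0 ≤ a l)
    (hp : ∀ l j : ℕ, j < 2 ^ l → p (j * (T / 2 ^ l)) (T / 2 ^ l) ≤ a l) (n : ℕ) :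
    ∀ i : ℕ, i ≤ 2 ^ n → r (i * (T / 2 ^ n)) ≤ ∑ l ∈ range (n + 1), a l := by
  induction n with
  | zero =>
    intro i hi
    have h1 := hr 0 T
    have h2 := hp 0 0 (by norm_num)
    rw [zero_add, h0, zero_add] at h1
    simp only [pow_zero, div_one, CharP.cast_eq_zero, zero_mul] at h2
    rcases Nat.le_one_iff_eq_zero_or_eq_one.1 (by simpa using hi) with rfl | rfl
    · simpa [h0] using ha 0
    · simpa using h1.trans h2
  | succ n ih =>
    intro i hi
    rw [Finset.sum_range_succ]
    have e : ∀ j : ℕ, ((2 * j : ℕ) : ℝ≥0) * (T / 2 ^ (n + 1)) = j * (T / 2 ^ n) := by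
      intro j; push_cast; field_simp; ring
    -- An even point lies on the coarser grid; an odd one is a single fine step to the right of it.
    rcases Nat.even_or_odd' i with ⟨j, rfl | rfl⟩
    · rw [e]
      exact (ih j (by rw [pow_succ] at hi; omega)).trans (le_add_of_nonneg_right (ha _))
    · have h1 := hr (j * (T / 2 ^ n)) (T / 2 ^ (n + 1))
      have h2 := hp (n + 1) (2 * j) (by omega)
      rw [e] at h2
      have h3 := ih j (by rw [pow_succ] at hi; omega)
      have e2 : ((2 * j + 1 : ℕ) : ℝ≥0) * (T / 2 ^ (n + 1)) = j * (T / 2 ^ n) + T / 2 ^ (n + 1) := by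
        rw [← e]; push_cast; ring
      rw [e2]
      linarith

/-- The chaining bound for a continuous function. -/
lemma le_of_dyadic_increments {r : ℝ≥0 → ℝ} {p : ℝ≥0 → ℝ≥0 → ℝ} {K : ℝ} {T : ℝ≥0} (hK : 0 ≤ K)
    (hc : Continuous r) (h0 : r 0 = 0) (hr : ∀ s h, r (s + h) ≤ r s + p s h)
    (hp : ∀ l j : ℕ, j < 2 ^ l → p (j * (T / 2 ^ l)) (T / 2 ^ l) ≤ K * (8 / 9) ^ l)
    {t : ℝ≥0} (ht : t ≤ T) : r t ≤ 9 * K := by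
  have hbound : ∀ n : ℕ, ∀ i : ℕ, i ≤ 2 ^ n → r (i * (T / 2 ^ n)) ≤ 9 * K := by
    intro n i hi
    refine (le_sum_of_dyadic_increments h0 hr (fun l => by positivity) hp n i hi).trans ?_
    rw [← Finset.mul_sum, mul_comm]
    refine mul_le_mul_of_nonneg_right ?_ hK
    -- The factor 9 is the sum of the geometric series of ratio 8/9.
    have h := (summable_geometric_of_lt_one (r := (8 / 9 : ℝ)) (by norm_num) (by norm_num)).sum_le_tsum
      (range (n + 1)) fun _ _ => by positivity
    rw [tsum_geometric_of_lt_one (by norm_num) (by norm_num)] at h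
    norm_num at h ⊢
    exact h
  rcases eq_or_ne T 0 with rfl | hT
  · rw [nonpos_iff_eq_zero.1 ht, h0]; positivity
  have hx : Tendsto (fun n : ℕ => ((⌊(t / T : ℝ) * 2 ^ n⌋₊ : ℝ≥0) * (T / 2 ^ n))) atTop (𝓝 t) := by
    have h1 := (tendsto_nat_floor_mul_div_atTop (R := ℝ) (a := t / T) (by positivity)).comp
      (tendsto_pow_atTop_atTop_of_one_lt (r := (2 : ℝ)) (by norm_num))
    have h2 := h1.mul_const (T : ℝ)
    rw [div_mul_cancel₀ _ (NNReal.coe_ne_zero.2 hT)] at h2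
    refine NNReal.tendsto_coe.1 (h2.congr fun n => ?_)
    simp only [Function.comp_apply]
    push_cast
    ring
  refine le_of_tendsto ((hc.tendsto t).comp hx) (Eventually.of_forall fun n => hbound n _ ?_)
  have h1 : (t / T : ℝ) ≤ 1 := div_le_one_of_le₀ ht T.2
  have h2 : (⌊(t / T : ℝ) * 2 ^ n⌋₊ : ℝ) ≤ 2 ^ n :=
    (Nat.floor_le (by positivity)).trans (mul_le_of_le_one_left (by positivity) h1)
  exact_mod_cast h2

variable {ε : ℝ} {α : ℂ} {m : ℝ} {w : ℝ≥0 → ℂ}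

/-- The energy of the stochastic convolution is controlled on `[0, T]` by its values on the dyadic
subintervals. -/
lemma energy_stochConv_le (hε : ε ≠ 0) (hα : 0 ≤ α.re) (hm : 0 ≤ m) (hw : Continuous w)
    (hw0 : w 0 = 0) {D : ℝ} {T : ℝ≥0} (hD : ∀ l j : ℕ, j < 2 ^ l → (9 / 8) ^ (4 * l) *
      energy m (stochConv ε α m (T / 2 ^ l) (shiftPath (j * (T / 2 ^ l)) w)) ^ 2 ≤ D)
    {t : ℝ≥0} (ht : t ≤ T) : energy m (stochConv ε α m t w) ≤ 81 * (1 + D) := by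
  have hD0 : 0 ≤ D := le_trans (by positivity) (hD 0 0 (by norm_num))
  -- K = D^{1/4}, since the hypothesis bounds the fourth power of (9/8)^l √E by D.
  set K := Real.sqrt (Real.sqrt D)
  have hK0 : 0 ≤ K := Real.sqrt_nonneg _
  have hK2 : K ^ 2 = Real.sqrt D := Real.sq_sqrt (Real.sqrt_nonneg _)
  have hK4 : K ^ 4 = D := by
    rw [show K ^ 4 = (K ^ 2) ^ 2 by ring, hK2, Real.sq_sqrt hD0]
  have key := le_of_dyadic_increments (r := fun t => Real.sqrt (energy m (stochConv ε α m t w)))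
    (p := fun s h => Real.sqrt (energy m (stochConv ε α m h (shiftPath s w)))) (T := T) hK0
    (((continuous_energy m).comp (continuous_stochConv ε α m hw hw0)).sqrt)
    (by simp [stochConv_zero, energy]) (fun s h => ?_) (fun l j hj => ?_) ht
  -- Squaring gives 81 √D; replacing √D by 1 + D makes the bound linear in D, so it can be summed
  -- over modes.
  · have h1 := pow_le_pow_left₀ (Real.sqrt_nonneg _) key 2
    rw [Real.sq_sqrt (energy_nonneg hm _)] at h1
    nlinarith [sq_nonneg (K ^ 2 - 1)]
  -- Restart at s: the flow contracts the energy, so the earlier value is not amplified.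
  · simp only [stochConv_add ε α m hw hw0 s h]
    refine (sqrt_energy_add_le hm _ _).trans (add_le_add_left (Real.sqrt_le_sqrt ?_) _)
    exact energy_flow_le hε hα h.2 _
  · have h1 := hD l j hj
    set e := energy m (stochConv ε α m (T / 2 ^ l) (shiftPath (j * (T / 2 ^ l)) w)) with he
    have he0 : 0 ≤ e := energy_nonneg hm _
    have h2 : ((9 / 8) ^ l * Real.sqrt e) ^ 4 ≤ K ^ 4 := by
      rw [hK4, mul_pow, ← pow_mul, mul_comm l 4,
        show Real.sqrt e ^ 4 = (Real.sqrt e ^ 2) ^ 2 by ring, Real.sq_sqrt he0]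
      exact h1
    have h3 := (pow_le_pow_iff_left₀ (by positivity) hK0 (by norm_num)).1 h2
    calc Real.sqrt e = ((9 / 8) ^ l * Real.sqrt e) * (8 / 9) ^ l := by
          rw [mul_right_comm, ← mul_pow]; norm_num
      _ ≤ K * (8 / 9) ^ l := by gcongr

end Chaining

/-! ### Gaussian laws of the approximating sums -/

section GaussianSums

variable {Ω : Type*} {mΩ : MeasurableSpace Ω} {P : Measure Ω} [IsProbabilityMeasure P]

lemma hasLaw_sum_range_gaussianReal {X : ℕ → Ω → ℝ} {v : ℕ → ℝ≥0}
    (hX : ∀ i, HasLaw (X i) (gaussianReal 0 (v i)) P) (hm : ∀ i, Measurable (X i))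
    (hi : iIndepFun X P) (n : ℕ) :
    HasLaw (fun ω => ∑ i ∈ range n, X i ω) (gaussianReal 0 (∑ i ∈ range n, v i)) P := by
  induction n with
  | zero =>
    simp only [range_zero, sum_empty, gaussianReal_zero_var]
    exact hasLaw_dirac_of_ae_eq (ae_of_all _ fun _ => rfl)
  | succ n ih =>
    have h := hi.indepFun_sum_range_succ hm n
    have e : (∑ j ∈ range n, X j) = fun ω => ∑ i ∈ range n, X i ω := by
      ext ω; simp
    rw [e] at h
    have key := gaussianReal_add_gaussianReal_of_indepFun h ih.map_eq (hX n).map_eq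
    refine ⟨by fun_prop, ?_⟩
    rw [Finset.sum_range_succ, ← zero_add (0 : ℝ), ← key]
    congr 1
    ext ω
    simp [Finset.sum_range_succ]

/-- Almost sure limits of centred real Gaussian variables are Gaussian. -/
lemma hasLaw_gaussianReal_of_tendsto {X : ℕ → Ω → ℝ} {Y : Ω → ℝ} {v : ℕ → ℝ≥0} {v' : ℝ≥0}
    (hX : ∀ n, HasLaw (X n) (gaussianReal 0 (v n)) P) (hY : AEMeasurable Y P)
    (h : ∀ᵐ ω ∂P, Tendsto (fun n => X n ω) atTop (𝓝 (Y ω))) (hv : Tendsto v atTop (𝓝 v')) :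
    HasLaw Y (gaussianReal 0 v') P := by
  refine ⟨hY, ?_⟩
  have := Measure.isProbabilityMeasure_map hY (μ := P)
  refine Measure.ext_of_charFun (funext fun u => ?_)
  have hc : ∀ Z : Ω → ℝ, AEMeasurable Z P →
      charFun (P.map Z) u = ∫ ω, Complex.exp (u * Z ω * Complex.I) ∂P := by
    intro Z hZ
    rw [charFun_apply_real, integral_map hZ (by fun_prop)]
  have h1 : Tendsto (fun n => charFun (P.map (X n)) u) atTop (𝓝 (charFun (P.map Y) u)) := by
    simp_rw [hc _ (hX _).aemeasurable, hc _ hY]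
    refine tendsto_integral_of_dominated_convergence (fun _ => 1)
      (fun n => ?_) (integrable_const _) (fun n => ae_of_all _ fun ω => ?_) ?_
    · have := (hX n).aemeasurable
      exact AEMeasurable.aestronglyMeasurable (by fun_prop)
    · rw [← Complex.ofReal_mul, Complex.norm_exp_ofReal_mul_I]
    · filter_upwards [h] with ω hω
      have : Continuous fun x : ℝ => Complex.exp (u * x * Complex.I) := by fun_prop
      exact (this.tendsto _).comp hω
  refine tendsto_nhds_unique h1 ?_
  simp_rw [(hX _).map_eq, charFun_gaussianReal]
  have : Continuous fun x : ℝ≥0 =>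
      Complex.exp (u * (0 : ℝ) * Complex.I - (x : ℝ) * u ^ 2 / 2) := by fun_prop
  exact (this.tendsto _).comp hv

variable {b b₀ b₁ : ℝ≥0 → Ω → ℝ}

lemma hasLaw_sum_increments (hb : IsPreBrownianReal b P) (hm : ∀ t, Measurable (b t)) (t : ℝ≥0)
    (c : ℕ → ℝ) (n : ℕ) :
    HasLaw (fun ω => ∑ i ∈ range n, c i * (b (t * ((i + 1 : ℕ) / n)) ω - b (t * (i / n)) ω))
      (gaussianReal 0 (∑ i ∈ range n, ‖c i‖₊ ^ 2 * (t / n))) P := by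
  have hmono : Monotone fun i : ℕ => t * ((i : ℝ≥0) / n) := fun i j hij => by
    dsimp only; gcongr
  refine hasLaw_sum_range_gaussianReal (fun i => ?_) (fun i => by fun_prop)
    ((hb.hasIndepIncrements.nat hmono).comp (fun i x => c i * x) (by fun_prop)) n
  have h := gaussianReal_const_mul (hb.hasLaw_sub (t * ((i + 1 : ℕ) / n)) (t * (i / n))) (c i)
  rw [mul_zero] at h
  have hv : ‖c i‖₊ ^ 2 * (t / n) = NNReal.mk (c i ^ 2) (sq_nonneg _)
      * nndist (t * ((i + 1 : ℕ) / n) : ℝ≥0).1 (t * (i / n) : ℝ≥0).1 := by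
    apply NNReal.eq
    rw [NNReal.coe_mul, NNReal.coe_mul, coe_nndist, Real.dist_eq, NNReal.coe_mk]
    change _ = c i ^ 2 * |((t * ((i + 1 : ℕ) / n) : ℝ≥0) : ℝ) - ((t * (i / n) : ℝ≥0) : ℝ)|
    push_cast
    rw [← mul_sub, ← sub_div, add_sub_cancel_left, abs_of_nonneg (by positivity),
      Real.norm_eq_abs, sq_abs]
    ring
  rw [hv]
  exact h

/-- The real linear form `x ↦ Re b(θ, x)`. -/
def pairingRe (m : ℝ) (θ : ℂ × ℂ) : StrongDual ℝ (ℂ × ℂ) :=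
  Complex.reCLM.comp ((ContinuousLinearMap.mul ℝ ℂ (-(m : ℂ) * θ.1)).comp
    (ContinuousLinearMap.fst ℝ ℂ ℂ)
    + (ContinuousLinearMap.mul ℝ ℂ θ.2).comp (ContinuousLinearMap.snd ℝ ℂ ℂ))

lemma pairingRe_apply (m : ℝ) (θ x : ℂ × ℂ) : pairingRe m θ x = (pairing m θ x).re := by
  simp [pairingRe, pairing]

/-- The complex Brownian motion with given real and imaginary parts. -/
def complexPath (p₀ p₁ : ℝ≥0 → ℝ) (t : ℝ≥0) : ℂ := p₀ t + Complex.I * p₁ t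

variable {ε : ℝ} {α : ℂ} {m : ℝ}

lemma pairingRe_flow (t : ℝ) (θ x : ℂ × ℂ) :
    pairingRe m θ (flow ε α m t x) = pairingRe m (flow ε α m t θ) x := by
  rw [pairingRe_apply, pairingRe_apply, pairing_flow]

lemma pairingRe_noiseDir (θ : ℂ × ℂ) (c : ℂ) : pairingRe m θ (noiseDir ε α c)
    = (2 * ε⁻¹ * Real.sqrt α.re * θ.2.re) * c.re + (-(2 * ε⁻¹ * Real.sqrt α.re * θ.2.im)) * c.im := by
  rw [pairingRe_apply, pairing, noiseDir_apply]
  simp only [← Complex.ofReal_inv, mul_zero, zero_add, Complex.mul_re, Complex.mul_im,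
    Complex.ofReal_re, Complex.ofReal_im, Complex.re_ofNat, Complex.im_ofNat]
  ring

/-- The rate at which the noise adds variance to the linear form `pairingRe m θ`. -/
def noiseRate (ε : ℝ) (α : ℂ) (m : ℝ) (θ : ℂ × ℂ) (s : ℝ≥0) : ℝ :=
  4 * α.re / ε ^ 2 * ‖(flow ε α m s θ).2‖ ^ 2

/-- Symmetry moves the flow from the noise onto θ. This leaves independent real increments with
deterministic coefficients, whose squares for `b₀` and `b₁` add up to `noiseRate`. -/
lemma hasLaw_pairingRe_stieltjesSum (hα : 0 ≤ α.re) (h₀ : IsPreBrownianReal b₀ P)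
    (h₁ : IsPreBrownianReal b₁ P) (hm₀ : ∀ t, Measurable (b₀ t)) (hm₁ : ∀ t, Measurable (b₁ t))
    (hi : IndepFun (fun ω t => b₀ t ω) (fun ω t => b₁ t ω) P) (θ : ℂ × ℂ) (t : ℝ≥0) (n : ℕ) :
    HasLaw (fun ω => pairingRe m θ (stieltjesSum (gen ε α m) (noiseDir ε α) t
        (complexPath (b₀ · ω) (b₁ · ω)) n))
      (gaussianReal 0
        (∑ i ∈ range n, (noiseRate ε α m θ (t * ((i + 1 : ℕ) / n))).toNNReal * (t / n))) P := by
  set y : ℕ → ℂ := fun i => (flow ε α m (t - t * (i / n)) θ).2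
  set c : ℕ → ℝ := fun i => 2 * ε⁻¹ * Real.sqrt α.re * (y i).re
  set d : ℕ → ℝ := fun i => -(2 * ε⁻¹ * Real.sqrt α.re * (y i).im)
  have e : (fun ω => pairingRe m θ (stieltjesSum (gen ε α m) (noiseDir ε α) t
        (complexPath (b₀ · ω) (b₁ · ω)) n))
      = (fun ω => ∑ i ∈ range n, c i * (b₀ (t * ((i + 1 : ℕ) / n)) ω - b₀ (t * (i / n)) ω))
        + fun ω => ∑ i ∈ range n, d i * (b₁ (t * ((i + 1 : ℕ) / n)) ω - b₁ (t * (i / n)) ω) := by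
    ext ω
    simp only [stieltjesSum, map_sum, Pi.add_apply, ← Finset.sum_add_distrib]
    refine Finset.sum_congr rfl fun i _ => ?_
    have := pairingRe_flow (ε := ε) (α := α) (m := m) (t - t * (i / n)) θ
      (noiseDir ε α (complexPath (b₀ · ω) (b₁ · ω) (t * ((i + 1 : ℕ) / n))
        - complexPath (b₀ · ω) (b₁ · ω) (t * (i / n))))
    rw [flow] at this
    rw [this, pairingRe_noiseDir]
    simp [complexPath, c, d, y, flow]
  have hind := hi.comp
    (φ := fun p : ℝ≥0 → ℝ => ∑ i ∈ range n, c i * (p (t * ((i + 1 : ℕ) / n)) - p (t * (i / n))))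
    (ψ := fun p : ℝ≥0 → ℝ => ∑ i ∈ range n, d i * (p (t * ((i + 1 : ℕ) / n)) - p (t * (i / n))))
    (by fun_prop) (by fun_prop)
  have hl₀ := hasLaw_sum_increments h₀ hm₀ t c n
  have hl₁ := hasLaw_sum_increments h₁ hm₁ t d n
  have key := gaussianReal_add_gaussianReal_of_indepFun hind hl₀.map_eq hl₁.map_eq
  rw [e]
  refine ⟨hl₀.aemeasurable.add hl₁.aemeasurable, key.trans ?_⟩
  -- The flow is evaluated at t minus the left endpoint; reversing the order of summation turns
  -- these times into right endpoints.
  rw [zero_add, ← Finset.sum_add_distrib, ← Finset.sum_range_reflect]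
  congr 1
  refine Finset.sum_congr rfl fun i hi => ?_
  have hin : i < n := Finset.mem_range.1 hi
  have hn : (n : ℝ) ≠ 0 := by exact_mod_cast (by omega : n ≠ 0)
  rw [← add_mul]
  congr 1
  have hy : y (n - 1 - i) = (flow ε α m ((t * ((i + 1 : ℕ) / n) : ℝ≥0) : ℝ) θ).2 := by
    simp only [y]
    congr 3
    have : ((n - 1 - i : ℕ) : ℝ) = n - 1 - i := by
      rw [Nat.sub_sub, Nat.cast_sub (by omega)]; push_cast; ring
    rw [this]
    push_cast
    field_simp
    ring
  ext
  rw [Real.coe_toNNReal _ (by unfold noiseRate; positivity), noiseRate, ← hy,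
    ← Complex.normSq_eq_norm_sq, Complex.normSq_apply]
  simp only [c, d, NNReal.coe_add, NNReal.coe_pow, coe_nnnorm, Real.norm_eq_abs, sq_abs, neg_sq,
    mul_pow, Real.sq_sqrt hα]
  ring

end GaussianSums

/-! ### Law and moments of the convolution on one mode -/

section ModeLaw

variable {Ω : Type*} {mΩ : MeasurableSpace Ω} {P : Measure Ω} [IsProbabilityMeasure P]

/-- `b₀` and `b₁` are independent real Brownian motions. -/
structure IsPlanarBrownian (b₀ b₁ : ℝ≥0 → Ω → ℝ) (P : Measure Ω) : Prop where
  fst : IsBrownianReal b₀ P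
  snd : IsBrownianReal b₁ P
  measurable_fst : ∀ t, Measurable (b₀ t)
  measurable_snd : ∀ t, Measurable (b₁ t)
  indep : IndepFun (fun ω t => b₀ t ω) (fun ω t => b₁ t ω) P

variable {b₀ b₁ : ℝ≥0 → Ω → ℝ} {ε : ℝ} {α : ℂ} {m : ℝ}

omit [IsProbabilityMeasure P] in
lemma IsPlanarBrownian.ae_continuous (h : IsPlanarBrownian b₀ b₁ P) :
    ∀ᵐ ω ∂P, Continuous (complexPath (b₀ · ω) (b₁ · ω))
      ∧ complexPath (b₀ · ω) (b₁ · ω) 0 = 0 := by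
  filter_upwards [h.fst.cont, h.snd.cont, h.fst.eval_zero_ae_eq_zero,
    h.snd.eval_zero_ae_eq_zero] with ω h1 h2 h3 h4
  refine ⟨?_, by simp [complexPath, h3, h4]⟩
  unfold complexPath
  fun_prop

omit [IsProbabilityMeasure P] in
lemma IsPlanarBrownian.measurable_stochConv (h : IsPlanarBrownian b₀ b₁ P) (t : ℝ≥0) :
    Measurable fun ω => stochConv ε α m t (complexPath (b₀ · ω) (b₁ · ω)) := by
  refine KleinGordon.measurable_stochConv ε α m fun s _ => ?_
  have := h.measurable_fst s
  have := h.measurable_snd s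
  unfold complexPath
  fun_prop

lemma continuous_noiseRate (θ : ℂ × ℂ) : Continuous (noiseRate ε α m θ) :=
  continuous_const.mul (((continuous_flow_snd θ).comp NNReal.continuous_coe).norm.pow 2)

lemma tendsto_sum_noiseRate (hε : ε ≠ 0) (hα : 0 ≤ α.re) (θ : ℂ × ℂ) (t : ℝ≥0) :
    Tendsto (fun n : ℕ => ∑ i ∈ range n,
      (noiseRate ε α m θ (t * ((i + 1 : ℕ) / n))).toNNReal * (t / n)) atTop
      (𝓝 (energy m θ - energy m (flow ε α m t θ)).toNNReal) := by
  -- Here the sampled "path" is the variance rate itself and the operator is the identity.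
  have h := tendsto_sum_integral (E := ℝ) (V := ℝ)
    (G := fun _ => ContinuousLinearMap.id ℝ ℝ) continuous_const
    (continuous_noiseRate (ε := ε) (α := α) (m := m) θ) t
  have e : ∫ s in (0 : ℝ)..t, noiseRate ε α m θ s.toNNReal
      = energy m θ - energy m (flow ε α m t θ) := by
    rw [← integral_norm_sq_flow hε]
    refine intervalIntegral.integral_congr fun s hs => ?_
    rw [Set.uIcc_of_le t.coe_nonneg] at hs
    simp only [noiseRate, Real.coe_toNNReal s hs.1]
  simp only [ContinuousLinearMap.id_apply, e] at h
  refine NNReal.tendsto_coe.1 ?_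
  rw [Real.coe_toNNReal _ (sub_nonneg.2 (energy_flow_le hε hα t.coe_nonneg θ))]
  refine h.congr fun n => ?_
  push_cast
  refine Finset.sum_congr rfl fun i _ => ?_
  have h0 : ∀ s, 0 ≤ noiseRate ε α m θ s := fun s => by unfold noiseRate; positivity
  rw [intervalIntegral.integral_const, smul_eq_mul, Real.coe_toNNReal _ (h0 _)]
  ring

/-- The real linear forms of the stochastic convolution are Gaussian. -/
lemma IsPlanarBrownian.hasLaw_pairingRe_stochConv (h : IsPlanarBrownian b₀ b₁ P) (hε : ε ≠ 0)
    (hα : 0 ≤ α.re) (θ : ℂ × ℂ) (t : ℝ≥0) :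
    HasLaw (fun ω => pairingRe m θ (stochConv ε α m t (complexPath (b₀ · ω) (b₁ · ω))))
      (gaussianReal 0 (energy m θ - energy m (flow ε α m t θ)).toNNReal) P := by
  refine hasLaw_gaussianReal_of_tendsto
    (hasLaw_pairingRe_stieltjesSum hα h.fst.toIsPreBrownianReal h.snd.toIsPreBrownianReal
      h.measurable_fst h.measurable_snd h.indep θ t)
    ((pairingRe m θ).measurable.comp (h.measurable_stochConv t)).aemeasurable ?_
    (tendsto_sum_noiseRate hε hα θ t)
  filter_upwards [h.ae_continuous] with ω hω
  exact ((pairingRe m θ).continuous.tendsto _).comp (tendsto_stochConv ε α m hω.1 hω.2 t)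

/-- The dissipation rate is at most a constant times the initial energy. As m enters only through
the energy, variances of unit-energy forms are O(t) uniformly in the mode. -/
lemma energy_sub_energy_flow_le (hε : ε ≠ 0) (hα : 0 ≤ α.re) (hm : 0 ≤ m) (θ : ℂ × ℂ) (t : ℝ≥0) :
    energy m θ - energy m (flow ε α m t θ) ≤ 4 * α.re / ε ^ 2 * energy m θ * t := by
  rw [← integral_norm_sq_flow hε]
  have hc : Continuous fun s => 4 * α.re / ε ^ 2 * ‖(flow ε α m s θ).2‖ ^ 2 :=
    continuous_const.mul ((continuous_flow_snd θ).norm.pow 2)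
  have h := intervalIntegral.integral_mono_on t.coe_nonneg (hc.intervalIntegrable (μ := volume) 0 t)
    (intervalIntegrable_const (c := 4 * α.re / ε ^ 2 * energy m θ)) fun s hs => ?_
  · rw [intervalIntegral.integral_const, smul_eq_mul, sub_zero] at h
    linarith
  · refine mul_le_mul_of_nonneg_left ?_ (by positivity)
    refine le_trans ?_ (energy_flow_le hε hα hs.1 θ)
    unfold energy
    have : 0 ≤ m * ‖(flow ε α m s θ).1‖ ^ 2 := by positivity
    linarith

lemma gaussianReal_zero_eq_map (v : ℝ≥0) :
    gaussianReal 0 v = (gaussianReal 0 1).map (fun x => Real.sqrt v * x) := by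
  rw [gaussianReal_map_const_mul]
  congr 1
  · simp
  · ext; simp [Real.sq_sqrt v.coe_nonneg]

/-- The fourth moment of the standard real Gaussian measure. -/
def gaussianFourth : ℝ≥0∞ := ∫⁻ x, ENNReal.ofReal (x ^ 4) ∂(gaussianReal 0 1)

lemma gaussianFourth_lt_top : gaussianFourth < ∞ := by
  have h := memLp_id_gaussianReal (μ := 0) (v := 1) 4
  have h1 := h.integrable_norm_pow (by norm_num : (4 : ℕ) ≠ 0)
  have h2 : Integrable (fun x : ℝ => x ^ 4) (gaussianReal 0 1) := by
    refine h1.congr (ae_of_all _ fun x => ?_)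
    simp only [id, Real.norm_eq_abs]
    exact Even.pow_abs (by decide) x
  refine lt_of_le_of_lt (lintegral_mono fun x => ?_) h2.hasFiniteIntegral
  rw [← ofReal_norm]
  exact ENNReal.ofReal_le_ofReal (le_abs_self _)

lemma lintegral_pow_four_gaussianReal (v : ℝ≥0) :
    ∫⁻ x, ENNReal.ofReal (x ^ 4) ∂(gaussianReal 0 v)
      = ENNReal.ofReal ((v : ℝ) ^ 2) * gaussianFourth := by
  rw [gaussianReal_zero_eq_map, lintegral_map (by fun_prop) (by fun_prop), gaussianFourth,
    ← lintegral_const_mul _ (by fun_prop)]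
  refine lintegral_congr fun x => ?_
  rw [← ENNReal.ofReal_mul (by positivity), mul_pow,
    show Real.sqrt v ^ 4 = (Real.sqrt v ^ 2) ^ 2 by ring, Real.sq_sqrt v.coe_nonneg]

/-- A basis of linear forms that is orthonormal for the energy. -/
def energyBasis (m : ℝ) : Fin 4 → ℂ × ℂ :=
  ![(((Real.sqrt m)⁻¹ : ℝ), 0), (((Real.sqrt m)⁻¹ : ℝ) * Complex.I, 0), (0, 1), (0, Complex.I)]

lemma energy_energyBasis (hm : 0 < m) (i : Fin 4) : energy m (energyBasis m i) = 1 := by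
  have h : m * (Real.sqrt m)⁻¹ ^ 2 = 1 := by
    rw [inv_pow, Real.sq_sqrt hm.le, mul_inv_cancel₀ hm.ne']
  have h' : m * (Real.sqrt m ^ 2)⁻¹ = 1 := by rw [← inv_pow, h]
  fin_cases i <;> simp [energyBasis, energy, h']

lemma energy_eq_sum (hm : 0 < m) (x : ℂ × ℂ) :
    energy m x = ∑ i, pairingRe m (energyBasis m i) x ^ 2 := by
  have hs : Real.sqrt m * Real.sqrt m = m := Real.mul_self_sqrt hm.le
  have h : m * (Real.sqrt m)⁻¹ = Real.sqrt m := by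
    rw [← div_eq_mul_inv, div_eq_iff (Real.sqrt_pos.2 hm).ne', hs]
  have e : m * (m * (Real.sqrt m)⁻¹ * (Real.sqrt m)⁻¹) = m := by rw [h, mul_inv_cancel₀
    (Real.sqrt_pos.2 hm).ne', mul_one]
  simp only [Fin.sum_univ_four, pairingRe_apply, pairing, energyBasis, energy,
    ← Complex.normSq_eq_norm_sq, Complex.normSq_apply]
  simp
  linear_combination (-(x.1.re ^ 2) - x.1.im ^ 2) * e

/-- Cauchy–Schwarz over four coordinates reduces the second moment of the energy to fourth moments
of real Gaussians. -/
lemma energy_sq_le (hm : 0 < m) (x : ℂ × ℂ) :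
    energy m x ^ 2 ≤ 4 * ∑ i, pairingRe m (energyBasis m i) x ^ 4 := by
  have h := sq_sum_le_card_mul_sum_sq (s := (univ : Finset (Fin 4)))
    (f := fun i => pairingRe m (energyBasis m i) x ^ 2)
  rw [energy_eq_sum hm]
  refine h.trans (le_of_eq ?_)
  simp [← pow_mul]

/-- The moment bound for the stochastic convolution, uniform in the Fourier mode. -/
lemma IsPlanarBrownian.lintegral_energy_sq_le (h : IsPlanarBrownian b₀ b₁ P) (hε : ε ≠ 0)
    (hα : 0 ≤ α.re) (hm : 0 < m) (t : ℝ≥0) :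
    ∫⁻ ω, ENNReal.ofReal (energy m (stochConv ε α m t (complexPath (b₀ · ω) (b₁ · ω))) ^ 2) ∂P
      ≤ 16 * gaussianFourth * ENNReal.ofReal ((4 * α.re / ε ^ 2 * t) ^ 2) := by
  have hmeas : ∀ i, Measurable fun ω => ENNReal.ofReal (pairingRe m (energyBasis m i)
      (stochConv ε α m t (complexPath (b₀ · ω) (b₁ · ω))) ^ 4) := fun i =>
    (((pairingRe m _).measurable.comp (h.measurable_stochConv t)).pow_const 4).ennreal_ofReal
  calc _ ≤ ∫⁻ ω, 4 * ∑ i, ENNReal.ofReal (pairingRe m (energyBasis m i)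
          (stochConv ε α m t (complexPath (b₀ · ω) (b₁ · ω))) ^ 4) ∂P := by
        refine lintegral_mono fun ω => ?_
        refine (ENNReal.ofReal_le_ofReal (energy_sq_le hm _)).trans (le_of_eq ?_)
        rw [ENNReal.ofReal_mul (by norm_num), ENNReal.ofReal_sum_of_nonneg fun _ _ => by positivity]
        norm_num
    _ = 4 * ∑ i, ∫⁻ ω, ENNReal.ofReal (pairingRe m (energyBasis m i)
          (stochConv ε α m t (complexPath (b₀ · ω) (b₁ · ω))) ^ 4) ∂P := by
        rw [lintegral_const_mul _ (Finset.measurable_fun_sum _ fun i _ => hmeas i),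
          lintegral_finsetSum _ fun i _ => hmeas i]
    _ ≤ 4 * ∑ i : Fin 4, gaussianFourth * ENNReal.ofReal ((4 * α.re / ε ^ 2 * t) ^ 2) := by
        gcongr with i
        have hl := h.hasLaw_pairingRe_stochConv (m := m) hε hα (energyBasis m i) t
        rw [hl.lintegral_comp (f := fun x => ENNReal.ofReal (x ^ 4)) (by fun_prop),
          lintegral_pow_four_gaussianReal, mul_comm]
        gcongr
        have h1 := energy_sub_energy_flow_le (m := m) hε hα hm.le (energyBasis m i) t
        rw [energy_energyBasis hm, mul_one] at h1
        refine Real.toNNReal_le_iff_le_coe (p := ⟨_, ?_⟩).2 ?_ 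
        · positivity
        · rw [energy_energyBasis hm]; exact h1
    _ = _ := by
        rw [Finset.sum_const, card_univ, Fintype.card_fin, nsmul_eq_mul]
        push_cast
        ring

end ModeLaw

/-! ### Invariance on one mode -/

section ModeInvariance

lemma charFunDual_complexGaussian (r : ℝ≥0) (c : ℂ) (L : StrongDual ℝ ℂ)
    (hL : ∀ z, L z = (c * z).re) :
    charFunDual (complexGaussian r) L = Complex.exp (-((r / 4 * ‖c‖ ^ 2 : ℝ) : ℂ)) := by
  rw [charFunDual_apply, complexGaussian, integral_map (by fun_prop) (by fun_prop)]
  have e : ∀ p : ℝ × ℝ, Complex.exp (L (p.1 + Complex.I * p.2) * Complex.I)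
      = Complex.exp (c.re * p.1 * Complex.I) * Complex.exp ((-c.im : ℝ) * p.2 * Complex.I) := by
    intro p
    rw [hL, ← Complex.exp_add]
    congr 1
    have : (c * (p.1 + Complex.I * p.2)).re = c.re * p.1 - c.im * p.2 := by simp
    rw [this]
    push_cast
    ring
  simp_rw [e]
  rw [integral_prod_mul (fun x : ℝ => Complex.exp (c.re * x * Complex.I))
    (fun x : ℝ => Complex.exp ((-c.im : ℝ) * x * Complex.I)), ← charFun_apply_real,
    ← charFun_apply_real, charFun_gaussianReal, charFun_gaussianReal, ← Complex.exp_add,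
    ← Complex.normSq_eq_norm_sq, Complex.normSq_apply]
  congr 1
  push_cast
  ring

/-- The invariant measure of a Fourier mode with symbol `m`. -/
def modeMeasure (m : ℝ≥0) : Measure (ℂ × ℂ) :=
  (complexGaussian (2 * m⁻¹)).prod (complexGaussian 2)

instance (m : ℝ≥0) : IsProbabilityMeasure (modeMeasure m) := by
  unfold modeMeasure; infer_instance

/-- The variance of Re b(θ, ·) is m²|θ₁|²/m + |θ₂|², the energy of θ. -/
lemma charFunDual_modeMeasure {m : ℝ≥0} (hm : 0 < m) (θ : ℂ × ℂ) :
    charFunDual (modeMeasure m) (pairingRe m θ) = Complex.exp (-((energy m θ / 2 : ℝ) : ℂ)) := by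
  rw [modeMeasure, charFunDual_prod,
    charFunDual_complexGaussian _ (-((m : ℝ) : ℂ) * θ.1) _ (fun z => by
      simp [pairingRe_apply, pairing]),
    charFunDual_complexGaussian _ θ.2 _ (fun z => by simp [pairingRe_apply, pairing]),
    ← Complex.exp_add]
  congr 1
  rw [← neg_add, ← Complex.ofReal_add]
  congr 2
  have : (m : ℝ) ≠ 0 := (NNReal.coe_pos.2 hm).ne'
  simp only [energy, norm_mul, norm_neg, Complex.norm_real, NNReal.norm_eq, NNReal.coe_mul,
    NNReal.coe_inv, NNReal.coe_ofNat]
  field_simp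
  ring

/-- The form is nondegenerate, so these linear forms suffice to identify a law. A real linear ℓ on ℂ
is Re(c z) with c = ℓ(1) - i ℓ(i), whence the witness. -/
lemma exists_eq_pairingRe {m : ℝ} (hm : m ≠ 0) (L : StrongDual ℝ (ℂ × ℂ)) :
    ∃ θ, L = pairingRe m θ := by
  refine ⟨(-(m : ℂ)⁻¹ * (L (1, 0) - L (Complex.I, 0) * Complex.I),
    L (0, 1) - L (0, Complex.I) * Complex.I), ?_⟩
  refine ContinuousLinearMap.ext fun x => ?_
  have hx : x = x.1.re • ((1 : ℂ), (0 : ℂ)) + x.1.im • (Complex.I, (0 : ℂ))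
      + x.2.re • ((0 : ℂ), (1 : ℂ)) + x.2.im • ((0 : ℂ), Complex.I) := by
    ext <;> simp
  have hl : L x = x.1.re * L (1, 0) + x.1.im * L (Complex.I, 0) + x.2.re * L (0, 1)
      + x.2.im * L (0, Complex.I) := by
    conv_lhs => rw [hx]
    simp only [map_add, map_smul, smul_eq_mul]
  have hc : -(m : ℂ) * (-(m : ℂ)⁻¹ * (L (1, 0) - L (Complex.I, 0) * Complex.I))
      = L (1, 0) - L (Complex.I, 0) * Complex.I := by
    have : (m : ℂ) ≠ 0 := Complex.ofReal_ne_zero.2 hm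
    field_simp
  rw [hl, pairingRe_apply, pairing, hc]
  simp
  ring

variable {Ω : Type*} {mΩ : MeasurableSpace Ω} {P : Measure Ω} [IsProbabilityMeasure P]
  {b₀ b₁ : ℝ≥0 → Ω → ℝ} {ε : ℝ} {α : ℂ}

/-- The invariance of the Gaussian measure of one Fourier mode. -/
lemma IsPlanarBrownian.map_modeMeasure_prod (h : IsPlanarBrownian b₀ b₁ P) (hε : ε ≠ 0)
    (hα : 0 ≤ α.re) {m : ℝ≥0} (hm : 0 < m) (t : ℝ≥0) :
    ((modeMeasure m).prod
      (P.map fun ω => stochConv ε α m t (complexPath (b₀ · ω) (b₁ · ω)))).map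
        (fun p => flow ε α m t p.1 + p.2) = modeMeasure m := by
  set N : Ω → ℂ × ℂ := fun ω => stochConv ε α m t (complexPath (b₀ · ω) (b₁ · ω))
  have hN : Measurable N := h.measurable_stochConv t
  have := Measure.isProbabilityMeasure_map hN.aemeasurable (μ := P)
  let F : (ℂ × ℂ) × (ℂ × ℂ) →L[ℝ] ℂ × ℂ :=
    (flow ε α m t).comp (ContinuousLinearMap.fst ℝ _ _) + ContinuousLinearMap.snd ℝ _ _
  change (Measure.prod _ _).map F = _
  have := Measure.isProbabilityMeasure_map F.measurable.aemeasurable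
    (μ := (modeMeasure m).prod (P.map N))
  refine Measure.ext_of_charFunDual (funext fun L => ?_)
  obtain ⟨θ, rfl⟩ := exists_eq_pairingRe (NNReal.coe_pos.2 hm).ne' L
  have h1 : ((pairingRe m θ).comp F).comp (ContinuousLinearMap.inl ℝ _ _)
      = pairingRe m (flow ε α m t θ) := by
    refine ContinuousLinearMap.ext fun x => ?_
    simp [F, pairingRe_flow]
  have h2 : ((pairingRe m θ).comp F).comp (ContinuousLinearMap.inr ℝ _ _) = pairingRe m θ := by
    refine ContinuousLinearMap.ext fun x => ?_
    simp [F]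
  have h3 : charFunDual (P.map N) (pairingRe m θ)
      = Complex.exp (-(((energy m θ - energy m (flow ε α m t θ)) / 2 : ℝ) : ℂ)) := by
    have hl := (h.hasLaw_pairingRe_stochConv (m := m) hε hα θ t).map_eq
    rw [charFunDual_eq_charFun_map_one, Measure.map_map (pairingRe m θ).measurable hN]
    erw [hl]
    rw [charFun_gaussianReal,
      Real.coe_toNNReal _ (sub_nonneg.2 (energy_flow_le hε hα t.coe_nonneg θ))]
    congr 1
    push_cast
    ring
  -- The energy left after the flow and the energy lost to damping add up to that of θ.
  rw [charFunDual_map, charFunDual_prod, h1, h2, h3, charFunDual_modeMeasure hm,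
    charFunDual_modeMeasure hm, ← Complex.exp_add]
  congr 1
  push_cast
  ring

end ModeInvariance

/-! ### Bounds uniform in time and summable over modes -/

section Bounds

lemma summable_int_one_add_sq_rpow {s : ℝ} (hs : 1 < s) :
    Summable fun n : ℤ => (1 + (n : ℝ) ^ 2) ^ (-(s / 2)) := by
  refine Summable.of_norm_bounded_eventually (Real.summable_abs_int_rpow hs) ?_
  filter_upwards [(Set.finite_singleton (0 : ℤ)).compl_mem_cofinite] with n hn
  have hn' : (0 : ℝ) < |(n : ℝ)| := abs_pos.2 (by exact_mod_cast hn)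
  rw [Real.norm_of_nonneg (by positivity)]
  calc (1 + (n : ℝ) ^ 2) ^ (-(s / 2)) ≤ (|(n : ℝ)| ^ 2) ^ (-(s / 2)) := by
        refine Real.rpow_le_rpow_of_nonpos (by positivity) ?_ (by linarith)
        rw [sq_abs]; linarith
    _ = |(n : ℝ)| ^ (-s) := by
        rw [← Real.rpow_natCast, ← Real.rpow_mul hn'.le]
        congr 1
        push_cast
        ring

lemma symb_eq (k : Freq) : (symb k : ℝ) = 1 + ((k.1 : ℝ) ^ 2 + (k.2 : ℝ) ^ 2) := by
  simp [symb, Nat.cast_natAbs]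

lemma symb_pos' (k : Freq) : 0 < symb k := by exact_mod_cast Sobolev.symb_pos k

/-- From (1 + a²)(1 + b²) ≤ (1 + a² + b²)² the double series is dominated by a product of two
convergent ones over ℤ. -/
lemma summable_symb_rpow {s : ℝ} (hs : s < -1) : Summable fun k => (symb k : ℝ) ^ s := by
  have h := summable_int_one_add_sq_rpow (s := -s) (by linarith)
  refine Summable.of_nonneg_of_le (fun k => Real.rpow_nonneg (Sobolev.symb_pos k).le _)
    (fun k => ?_) (h.mul_of_nonneg h (fun n => by positivity) (fun n => by positivity))
  rw [symb_eq]
  have h1 : (0 : ℝ) < 1 + (k.1 : ℝ) ^ 2 := by positivity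
  have h2 : (0 : ℝ) < 1 + (k.2 : ℝ) ^ 2 := by positivity
  rw [← Real.mul_rpow h1.le h2.le, neg_div, neg_neg]
  have h3 : ∀ x : ℝ, 0 < x → x ^ s = (x ^ 2) ^ (s / 2) := fun x hx => by
    rw [← Real.rpow_natCast, ← Real.rpow_mul hx.le]
    congr 1
    push_cast
    ring
  rw [h3 _ (by positivity)]
  refine Real.rpow_le_rpow_of_nonpos (by positivity) ?_ (by linarith)
  nlinarith [sq_nonneg (k.1 : ℝ), sq_nonneg (k.2 : ℝ), mul_nonneg (sq_nonneg (k.1 : ℝ))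
    (sq_nonneg (k.2 : ℝ)), sq_nonneg ((k.1 : ℝ) ^ 2), sq_nonneg ((k.2 : ℝ) ^ 2)]

variable {Ω : Type*} {mΩ : MeasurableSpace Ω} {P : Measure Ω} [IsProbabilityMeasure P]
  {b₀ b₁ : ℝ≥0 → Ω → ℝ} {ε : ℝ} {α : ℂ} {m : ℝ}

lemma shiftPath_complexPath (s : ℝ≥0) (p₀ p₁ : ℝ≥0 → ℝ) :
    shiftPath s (complexPath p₀ p₁) = complexPath (shiftPath s p₀) (shiftPath s p₁) := by
  ext t
  simp only [shiftPath, complexPath]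
  push_cast
  ring

omit [IsProbabilityMeasure P] in
lemma IsPlanarBrownian.shift (h : IsPlanarBrownian b₀ b₁ P) (s : ℝ≥0) :
    IsPlanarBrownian (fun t ω => shiftPath s (b₀ · ω) t) (fun t ω => shiftPath s (b₁ · ω) t) P where
  fst := h.fst.shift s
  snd := h.snd.shift s
  measurable_fst t := (h.measurable_fst _).sub (h.measurable_fst _)
  measurable_snd t := (h.measurable_snd _).sub (h.measurable_snd _)
  indep := h.indep.comp (φ := shiftPath s) (ψ := shiftPath s)
    (measurable_pi_lambda _ fun t => by unfold shiftPath; fun_prop)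
    (measurable_pi_lambda _ fun t => by unfold shiftPath; fun_prop)

/-- The sum over all dyadic subintervals of `[0, T]` that controls the stochastic convolution. -/
def dyadicSum (ε : ℝ) (α : ℂ) (m : ℝ) (T : ℝ≥0) (w : ℝ≥0 → ℂ) : ℝ≥0∞ :=
  ∑' l : ℕ, ∑ j ∈ range (2 ^ l), ENNReal.ofReal ((9 / 8) ^ (4 * l) *
    energy m (stochConv ε α m (T / 2 ^ l) (shiftPath (j * (T / 2 ^ l)) w)) ^ 2)

lemma energy_stochConv_le_dyadicSum (hε : ε ≠ 0) (hα : 0 ≤ α.re) (hm : 0 ≤ m) {w : ℝ≥0 → ℂ}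
    (hw : Continuous w) (hw0 : w 0 = 0) {T : ℝ≥0} (hD : dyadicSum ε α m T w ≠ ∞) {t : ℝ≥0}
    (ht : t ≤ T) :
    energy m (stochConv ε α m t w) ≤ 81 * (1 + (dyadicSum ε α m T w).toReal) := by
  refine energy_stochConv_le hε hα hm hw hw0 (fun l j hj => ?_) ht
  refine (ENNReal.ofReal_le_iff_le_toReal hD).1 ?_
  refine le_trans ?_ (ENNReal.le_tsum l)
  exact Finset.single_le_sum (f := fun j : ℕ => ENNReal.ofReal ((9 / 8) ^ (4 * l) *
    energy m (stochConv ε α m (T / 2 ^ l) (shiftPath (j * (T / 2 ^ l)) w)) ^ 2))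
    (fun _ _ => zero_le) (Finset.mem_range.2 hj)

omit [IsProbabilityMeasure P] in
lemma IsPlanarBrownian.measurable_dyadicSum_term (h : IsPlanarBrownian b₀ b₁ P) (T : ℝ≥0)
    (l j : ℕ) : Measurable fun ω => ENNReal.ofReal ((9 / 8) ^ (4 * l) *
      energy m (stochConv ε α m (T / 2 ^ l)
        (shiftPath (j * (T / 2 ^ l)) (complexPath (b₀ · ω) (b₁ · ω)))) ^ 2) := by
  simp_rw [shiftPath_complexPath]
  have h1 := (h.shift (j * (T / 2 ^ l))).measurable_stochConv (ε := ε) (α := α) (m := m) (T / 2 ^ l)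
  exact ((((continuous_energy m).measurable.comp h1).pow_const 2).const_mul _).ennreal_ofReal

omit [IsProbabilityMeasure P] in
lemma IsPlanarBrownian.measurable_dyadicSum (h : IsPlanarBrownian b₀ b₁ P) (T : ℝ≥0) :
    Measurable fun ω => dyadicSum ε α m T (complexPath (b₀ · ω) (b₁ · ω)) :=
  Measurable.tsum fun l =>
    Finset.measurable_fun_sum _ fun j _ => h.measurable_dyadicSum_term T l j

/-- The bound for the expectation of `dyadicSum`. -/
def dyadicBound (ε : ℝ) (α : ℂ) (T : ℝ≥0) : ℝ≥0∞ :=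
  16 * gaussianFourth * ENNReal.ofReal (∑' l : ℕ, (4 * α.re / ε ^ 2 * T) ^ 2 * ((9 / 8) ^ 4 / 2) ^ l)

lemma dyadicBound_lt_top (ε : ℝ) (α : ℂ) (T : ℝ≥0) : dyadicBound ε α T < ∞ :=
  ENNReal.mul_lt_top (ENNReal.mul_lt_top (by norm_num) gaussianFourth_lt_top) ENNReal.ofReal_lt_top

/-- Level l has 2^l intervals, each contributing O(4^{-l}) times the weight (9/8)^{4l}. The ratio
(9/8)⁴/2 is below 1, while 8/9 < 1 is what the chaining needs. The bound is free of m. -/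
lemma IsPlanarBrownian.lintegral_dyadicSum_le (h : IsPlanarBrownian b₀ b₁ P) (hε : ε ≠ 0)
    (hα : 0 ≤ α.re) (hm : 0 < m) (T : ℝ≥0) :
    ∫⁻ ω, dyadicSum ε α m T (complexPath (b₀ · ω) (b₁ · ω)) ∂P ≤ dyadicBound ε α T := by
  unfold dyadicSum
  rw [lintegral_tsum fun l => (Finset.measurable_fun_sum _ fun j _ =>
    h.measurable_dyadicSum_term T l j).aemeasurable, dyadicBound,
    ENNReal.ofReal_tsum_of_nonneg (fun l => by positivity)
      ((summable_geometric_of_lt_one (by norm_num) (by norm_num)).mul_left _),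
    ← ENNReal.tsum_mul_left]
  refine ENNReal.tsum_le_tsum fun l => ?_
  rw [lintegral_finsetSum _ fun j _ => h.measurable_dyadicSum_term T l j]
  have hterm : ∀ j : ℕ, ∫⁻ ω, ENNReal.ofReal ((9 / 8) ^ (4 * l) *
      energy m (stochConv ε α m (T / 2 ^ l)
        (shiftPath (j * (T / 2 ^ l)) (complexPath (b₀ · ω) (b₁ · ω)))) ^ 2) ∂P
      ≤ ENNReal.ofReal ((9 / 8) ^ (4 * l)) * (16 * gaussianFourth *
        ENNReal.ofReal ((4 * α.re / ε ^ 2 * (T / 2 ^ l : ℝ≥0)) ^ 2)) := by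
    intro j
    simp_rw [shiftPath_complexPath, ENNReal.ofReal_mul (p := (9 / 8 : ℝ) ^ (4 * l)) (by positivity)]
    rw [lintegral_const_mul' _ _ ENNReal.ofReal_ne_top]
    gcongr
    exact (h.shift (j * (T / 2 ^ l))).lintegral_energy_sq_le hε hα hm (T / 2 ^ l)
  refine (Finset.sum_le_sum fun j _ => hterm j).trans (le_of_eq ?_)
  rw [Finset.sum_const, card_range, nsmul_eq_mul]
  have e : ((2 ^ l : ℕ) : ℝ≥0∞) = ENNReal.ofReal (2 ^ l) := by
    rw [ENNReal.ofReal_pow (by norm_num)]; simp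
  rw [e, mul_left_comm (ENNReal.ofReal _) (16 * gaussianFourth),
    mul_left_comm (ENNReal.ofReal _) (16 * gaussianFourth), ← ENNReal.ofReal_mul (by positivity),
    ← ENNReal.ofReal_mul (by positivity)]
  congr 2
  push_cast
  rw [div_pow ((9 / 8 : ℝ) ^ 4), pow_mul]
  field_simp

variable {β : Freq × Fin 2 → ℝ≥0 → Ω → ℝ}

/-- Almost surely, the stochastic convolutions of all Fourier modes are bounded in `ℋ^{-δ}`,
locally uniformly in time. -/
lemma ae_exists_summable_bound (hβ : ∀ k, IsPlanarBrownian (β (k, 0)) (β (k, 1)) P) (hε : ε ≠ 0)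
    (hα : 0 ≤ α.re) {s : ℝ} (hs : s < -1) :
    ∀ᵐ ω ∂P, ∀ T : ℕ, ∃ b : Freq → ℝ, (Summable fun k => (symb k : ℝ) ^ s * b k) ∧
      ∀ k, ∀ t : ℝ≥0, t ≤ T → energy (symb k)
        (stochConv ε α (symb k) t (complexPath (β (k, 0) · ω) (β (k, 1) · ω))) ≤ b k := by
  rw [ae_all_iff]
  intro T
  set D : Freq → Ω → ℝ≥0∞ := fun k ω =>
    dyadicSum ε α (symb k) T (complexPath (β (k, 0) · ω) (β (k, 1) · ω))
  have hDm : ∀ k, Measurable (D k) := fun k => (hβ k).measurable_dyadicSum T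
  -- The expectations of the D k share one finite bound, so summability of the weights suffices.
  have hfin : ∫⁻ ω, ∑' k, ENNReal.ofReal ((symb k : ℝ) ^ s) * D k ω ∂P ≠ ∞ := by
    rw [lintegral_tsum fun k => ((hDm k).const_mul _).aemeasurable]
    refine ne_top_of_le_ne_top (b := ∑' k, ENNReal.ofReal ((symb k : ℝ) ^ s) * dyadicBound ε α T)
      ?_ (ENNReal.tsum_le_tsum fun k => ?_)
    · rw [ENNReal.tsum_mul_right, ← ENNReal.ofReal_tsum_of_nonneg
        (fun k => Real.rpow_nonneg (Sobolev.symb_pos k).le _) (summable_symb_rpow hs)]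
      exact ENNReal.mul_ne_top ENNReal.ofReal_ne_top (dyadicBound_lt_top ε α T).ne
    · rw [lintegral_const_mul _ (hDm k)]
      gcongr
      exact (hβ k).lintegral_dyadicSum_le hε hα (Sobolev.symb_pos k) T
  filter_upwards [ae_lt_top (Measurable.tsum fun k => (hDm k).const_mul _) hfin,
    ae_all_iff.2 fun k => (hβ k).ae_continuous] with ω hω hc
  have hDk : ∀ k, D k ω ≠ ∞ := fun k hk => by
    have h1 := (ENNReal.le_tsum (f := fun k => ENNReal.ofReal ((symb k : ℝ) ^ s) * D k ω) k).trans_lt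
      hω
    rw [hk, ENNReal.mul_top (by simpa using Real.rpow_pos_of_pos (Sobolev.symb_pos k) s)] at h1
    exact lt_irrefl _ h1
  refine ⟨fun k => 81 * (1 + (D k ω).toReal), ?_, fun k t ht =>
    energy_stochConv_le_dyadicSum hε hα (symb k).2 (hc k).1 (hc k).2 (hDk k) ht⟩
  have h2 := ENNReal.summable_toReal hω.ne
  refine (((summable_symb_rpow hs).add h2).mul_left 81).congr fun k => ?_
  rw [ENNReal.toReal_mul, ENNReal.toReal_ofReal (Real.rpow_nonneg (Sobolev.symb_pos k).le _)]
  ring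

end Bounds

/-! ### Convergence and measurability in H^s through coefficients -/

namespace Sobolev

variable {s : ℝ}

lemma hasSum_dist_sq (u v : Sobolev s) :
    HasSum (fun k => (symb k : ℝ) ^ s * ‖u.coeff k - v.coeff k‖ ^ 2) (dist u v ^ 2) := by
  have h := lp.hasSum_norm (p := 2) (by norm_num) (toL2 u - toL2 v)
  have e : dist u v = ‖toL2 u - toL2 v‖ := dist_eq_norm (toL2 u) (toL2 v)
  rw [e]
  simp only [ENNReal.toReal_ofNat, Real.rpow_ofNat] at h
  refine h.congr_fun fun k => ?_
  have h2 : ((symb k : ℝ) ^ (s / 2)) ^ 2 = (symb k : ℝ) ^ s := by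
    rw [← Real.rpow_natCast, ← Real.rpow_mul (symb_pos k).le]
    norm_num
  have e2 : (toL2 u - toL2 v) k
      = (((symb k : ℝ) ^ (s / 2) : ℝ) : ℂ) * (u.coeff k - v.coeff k) := by
    rw [mul_sub]; rfl
  rw [e2, norm_mul, mul_pow, Complex.norm_real, Real.norm_eq_abs, sq_abs, h2]

/-- Dominated convergence for the series of the squared distance. -/
lemma tendsto_of_coeff {ι : Type*} {l : Filter ι} {f : ι → Sobolev s} {u : Sobolev s}
    (h : ∀ k, Tendsto (fun i => (f i).coeff k) l (𝓝 (u.coeff k))) {b : Freq → ℝ}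
    (hb : Summable fun k => (symb k : ℝ) ^ s * b k)
    (hf : ∀ᶠ i in l, ∀ k, ‖(f i).coeff k - u.coeff k‖ ^ 2 ≤ b k) : Tendsto f l (𝓝 u) := by
  rw [tendsto_iff_dist_tendsto_zero]
  have h1 : Tendsto (fun i => ∑' k, (symb k : ℝ) ^ s * ‖(f i).coeff k - u.coeff k‖ ^ 2) l
      (𝓝 (∑' _ : Freq, (0 : ℝ))) := by
    refine tendsto_tsum_of_dominated_convergence hb (fun k => ?_) ?_
    · have : Tendsto (fun i => (f i).coeff k - u.coeff k) l (𝓝 0) := by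
        simpa using (h k).sub_const (u.coeff k)
      simpa using ((this.norm.pow 2).const_mul ((symb k : ℝ) ^ s))
    · filter_upwards [hf] with i hi k
      have h0 := Real.rpow_nonneg (symb_pos k).le s
      rw [Real.norm_of_nonneg (by positivity)]
      exact mul_le_mul_of_nonneg_left (hi k) h0
  simp only [(hasSum_dist_sq _ _).tsum_eq, tsum_zero] at h1
  have h2 := h1.sqrt
  simpa [Real.sqrt_sq dist_nonneg] using h2

lemma continuous_coeff (k : Freq) : Continuous fun u : Sobolev s => u.coeff k := by
  refine continuous_iff_continuousAt.2 fun u => ?_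
  rw [ContinuousAt, tendsto_iff_norm_sub_tendsto_zero]
  have hpos := Real.rpow_pos_of_pos (symb_pos k) s
  have h0 : Tendsto (fun v => Real.sqrt (((symb k : ℝ) ^ s)⁻¹ * dist v u ^ 2)) (𝓝 u) (𝓝 0) := by
    have : Continuous fun v => Real.sqrt (((symb k : ℝ) ^ s)⁻¹ * dist v u ^ 2) := by fun_prop
    simpa using this.tendsto u
  refine squeeze_zero (fun _ => norm_nonneg _) (fun v => ?_) h0
  refine Real.le_sqrt_of_sq_le ?_
  rw [inv_mul_eq_div, le_div_iff₀' hpos]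
  exact le_hasSum (hasSum_dist_sq v u) k fun j _ => by
    have := Real.rpow_nonneg (symb_pos j).le s
    positivity

lemma measurable_coeff (k : Freq) : Measurable fun u : Sobolev s => u.coeff k :=
  (continuous_coeff k).measurable

/-- The element of `H^s` with finitely many given Fourier coefficients. -/
def ofFinset (F : Finset Freq) (c : F → ℂ) : Sobolev s where
  coeff k := if h : k ∈ F then c ⟨k, h⟩ else 0
  summable_coeff := summable_of_ne_finset_zero (s := F) fun k hk => by simp [hk]

lemma continuous_ofFinset (F : Finset Freq) : Continuous (ofFinset (s := s) F) := by
  refine continuous_iff_continuousAt.2 fun c => ?_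
  refine tendsto_of_coeff (b := fun k => if k ∈ F then 1 else 0) (fun k => ?_)
    (summable_of_ne_finset_zero (s := F) fun k hk => by simp [hk]) ?_
  · by_cases hk : k ∈ F
    · simpa [ofFinset, hk] using (continuous_apply (⟨k, hk⟩ : F)).tendsto c
    · simp [ofFinset, hk]
  · filter_upwards [Metric.ball_mem_nhds c one_pos] with c' hc' k
    by_cases hk : k ∈ F
    · have h1 := (dist_le_pi_dist c' c ⟨k, hk⟩).trans (le_of_lt hc')
      rw [dist_eq_norm] at h1
      simpa [ofFinset, hk] using h1
    · simp [ofFinset, hk]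

/-- Each element is the limit of its finite truncations, which depend continuously on finitely many
coefficients. -/
lemma measurable_of_coeff {S : Type*} [MeasurableSpace S] {f : S → Sobolev s}
    (hf : ∀ k, Measurable fun a => (f a).coeff k) : Measurable f := by
  refine measurable_of_tendsto_metrizable' (f := fun (F : Finset Freq) a =>
    (ofFinset F fun k => (f a).coeff k : Sobolev s)) atTop (fun F => ?_) (tendsto_pi_nhds.2 fun a => ?_)
  · exact (continuous_ofFinset F).measurable.comp (measurable_pi_lambda _ fun k => hf k)
  · refine tendsto_of_coeff (b := fun k => ‖(f a).coeff k‖ ^ 2) (fun k => ?_) (f a).summable_coeff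
      (Eventually.of_forall fun F k => ?_)
    · refine tendsto_const_nhds.congr' ?_
      filter_upwards [eventually_ge_atTop {k}] with F hF
      simp [ofFinset, Finset.singleton_subset_iff.1 hF]
    · by_cases hk : k ∈ F <;> simp [ofFinset, hk]

open Classical in
/-- The element of `H^s` with given Fourier coefficients, and `0` if there is none. -/
def ofCoeff (s : ℝ) (c : Freq → ℂ) : Sobolev s :=
  if h : Summable fun k => (symb k : ℝ) ^ s * ‖c k‖ ^ 2 then ⟨c, h⟩ else ⟨0, by simp⟩

lemma coeff_ofCoeff {c : Freq → ℂ} (h : Summable fun k => (symb k : ℝ) ^ s * ‖c k‖ ^ 2) :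
    (ofCoeff s c).coeff = c := by
  rw [ofCoeff, dif_pos h]

lemma ofCoeff_coeff (u : Sobolev s) : ofCoeff s u.coeff = u :=
  Sobolev.ext (coeff_ofCoeff u.summable_coeff)

lemma measurableSet_summable (s : ℝ) :
    MeasurableSet {c : Freq → ℂ | Summable fun k => (symb k : ℝ) ^ s * ‖c k‖ ^ 2} :=
  MeasureTheory.measurableSet_exists_tendsto (l := atTop)
    (f := fun (F : Finset Freq) (c : Freq → ℂ) => ∑ k ∈ F, (symb k : ℝ) ^ s * ‖c k‖ ^ 2)
    fun F => by fun_prop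

lemma measurable_ofCoeff (s : ℝ) : Measurable (ofCoeff s) := by
  classical
  refine measurable_of_coeff fun k => ?_
  have e : (fun c => (ofCoeff s c).coeff k)
      = fun c => if c ∈ {c : Freq → ℂ | Summable fun k => (symb k : ℝ) ^ s * ‖c k‖ ^ 2}
        then c k else 0 := by
    ext c
    by_cases h : Summable fun k => (symb k : ℝ) ^ s * ‖c k‖ ^ 2 <;> simp [ofCoeff, h]
  rw [e]
  exact Measurable.ite (measurableSet_summable s) (measurable_pi_apply k) measurable_const

/-- Coefficientwise continuous paths with a locally uniform bound are continuous in `H^s`. -/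
lemma continuous_of_coeff {f : ℝ≥0 → Sobolev s} (hc : ∀ k, Continuous fun t => (f t).coeff k)
    (hb : ∀ T : ℕ, ∃ b : Freq → ℝ, (Summable fun k => (symb k : ℝ) ^ s * b k) ∧
      ∀ k, ∀ t : ℝ≥0, t ≤ T → ‖(f t).coeff k‖ ^ 2 ≤ b k) : Continuous f := by
  refine continuous_iff_continuousAt.2 fun t => ?_
  obtain ⟨T, hT⟩ := exists_nat_gt t
  obtain ⟨b, hb, hbound⟩ := hb T
  refine tendsto_of_coeff (b := fun k => 4 * b k) (fun k => (hc k).tendsto t) ?_ ?_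
  · exact (hb.mul_left 4).congr fun k => by ring
  · filter_upwards [Iic_mem_nhds hT] with u hu k
    have h1 := hbound k u hu
    have h2 := hbound k t hT.le
    have h3 := norm_sub_le ((f u).coeff k) ((f t).coeff k)
    have h4 := pow_le_pow_left₀ (norm_nonneg _) h3 2
    nlinarith [sq_nonneg (‖(f u).coeff k‖ - ‖(f t).coeff k‖)]

end Sobolev

/-! ### The phase space inside sequences -/

namespace Phase

variable {δ : ℝ}

lemma measurable_coeffs : Measurable (coeffs (δ := δ)) :=
  (measurable_pi_lambda _ fun k => (Sobolev.measurable_coeff k).comp measurable_fst).prodMk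
    (measurable_pi_lambda _ fun k => (Sobolev.measurable_coeff k).comp measurable_snd)

/-- The element of `ℋ^{-δ}` with given Fourier coefficients. -/
def ofCoeffs (δ : ℝ) (c : (Freq → ℂ) × (Freq → ℂ)) : Phase δ :=
  (Sobolev.ofCoeff _ c.1, Sobolev.ofCoeff _ c.2)

lemma measurable_ofCoeffs (δ : ℝ) : Measurable (ofCoeffs δ) :=
  ((Sobolev.measurable_ofCoeff _).comp measurable_fst).prodMk
    ((Sobolev.measurable_ofCoeff _).comp measurable_snd)

lemma ofCoeffs_coeffs (x : Phase δ) : ofCoeffs δ x.coeffs = x :=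
  Prod.ext (Sobolev.ofCoeff_coeff _) (Sobolev.ofCoeff_coeff _)

lemma range_coeffs : Set.range (coeffs (δ := δ))
    = {c | Summable fun k => (symb k : ℝ) ^ (-δ) * ‖c k‖ ^ 2}
      ×ˢ {c | Summable fun k => (symb k : ℝ) ^ (-δ - 1) * ‖c k‖ ^ 2} := by
  ext c
  constructor
  · rintro ⟨x, rfl⟩
    exact ⟨x.1.summable_coeff, x.2.summable_coeff⟩
  · rintro ⟨h1, h2⟩
    exact ⟨(⟨c.1, h1⟩, ⟨c.2, h2⟩), rfl⟩

/-- This gives content to `phaseMeasure`: `Measure.comap` takes the default value 0 without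
injectivity and measurable images. -/
lemma measurableEmbedding_coeffs : MeasurableEmbedding (coeffs (δ := δ)) := by
  refine MeasurableEmbedding.of_measurable_inverse measurable_coeffs ?_ (measurable_ofCoeffs δ)
    ofCoeffs_coeffs
  rw [range_coeffs]
  exact (Sobolev.measurableSet_summable _).prod (Sobolev.measurableSet_summable _)

end Phase

/-! ### Support of the Gaussian measure -/

section GaussianMeasure

lemma lintegral_sq_gaussianReal (v : ℝ≥0) :
    ∫⁻ x, ENNReal.ofReal (x ^ 2) ∂(gaussianReal 0 v) = v := by
  have hi : Integrable (fun x : ℝ => x ^ 2) (gaussianReal 0 v) :=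
    (memLp_id_gaussianReal (μ := 0) (v := v) 2).integrable_sq
  rw [← ofReal_integral_eq_lintegral_ofReal hi (ae_of_all _ fun x => sq_nonneg x)]
  have h := variance_of_integral_eq_zero (X := id) (μ := gaussianReal 0 v) (by fun_prop)
    integral_id_gaussianReal
  rw [variance_id_gaussianReal] at h
  have h' : ∫ x, x ^ 2 ∂(gaussianReal 0 v) = v := h.symm
  rw [h', ENNReal.ofReal_coe_nnreal]

lemma lintegral_norm_sq_complexGaussian (r : ℝ≥0) :
    ∫⁻ z, ENNReal.ofReal (‖z‖ ^ 2) ∂(complexGaussian r) = r := by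
  rw [complexGaussian, lintegral_map (by fun_prop) (by fun_prop)]
  have e : ∀ p : ℝ × ℝ, ENNReal.ofReal (‖(p.1 : ℂ) + Complex.I * p.2‖ ^ 2)
      = ENNReal.ofReal (p.1 ^ 2) + ENNReal.ofReal (p.2 ^ 2) := by
    intro p
    rw [← ENNReal.ofReal_add (sq_nonneg _) (sq_nonneg _), ← Complex.normSq_eq_norm_sq,
      Complex.normSq_apply]
    simp [sq]
  simp_rw [e]
  rw [lintegral_add_left (by fun_prop)]
  have h1 : ∫⁻ p : ℝ × ℝ, ENNReal.ofReal (p.1 ^ 2)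
      ∂((gaussianReal 0 (r / 2)).prod (gaussianReal 0 (r / 2))) = (r / 2 : ℝ≥0) := by
    rw [lintegral_prod _ (by fun_prop)]
    simp [lintegral_sq_gaussianReal]
  have h2 : ∫⁻ p : ℝ × ℝ, ENNReal.ofReal (p.2 ^ 2)
      ∂((gaussianReal 0 (r / 2)).prod (gaussianReal 0 (r / 2))) = (r / 2 : ℝ≥0) := by
    rw [lintegral_prod _ (by fun_prop)]
    simp [lintegral_sq_gaussianReal]
  rw [h1, h2, ← ENNReal.coe_add, add_halves]

/-- The hypothesis says that the expected squared Sobolev norm is finite. -/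
lemma ae_summable_infinitePi_complexGaussian {s : ℝ} {r : Freq → ℝ≥0}
    (hr : Summable fun k => (symb k : ℝ) ^ s * r k) :
    ∀ᵐ c ∂(Measure.infinitePi fun k => complexGaussian (r k)),
      Summable fun k => (symb k : ℝ) ^ s * ‖c k‖ ^ 2 := by
  have hpos : ∀ k, 0 ≤ (symb k : ℝ) ^ s := fun k => Real.rpow_nonneg (Sobolev.symb_pos k).le _
  have hm : ∀ k, Measurable fun c : Freq → ℂ => ENNReal.ofReal ((symb k : ℝ) ^ s * ‖c k‖ ^ 2) :=
    fun k => by fun_prop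
  have hfin : ∫⁻ c, ∑' k, ENNReal.ofReal ((symb k : ℝ) ^ s * ‖c k‖ ^ 2)
      ∂(Measure.infinitePi fun k => complexGaussian (r k)) ≠ ∞ := by
    rw [lintegral_tsum fun k => (hm k).aemeasurable]
    have e : ∀ k, ∫⁻ c, ENNReal.ofReal ((symb k : ℝ) ^ s * ‖c k‖ ^ 2)
        ∂(Measure.infinitePi fun k => complexGaussian (r k))
        = ENNReal.ofReal ((symb k : ℝ) ^ s * r k) := by
      intro k
      have := (measurePreserving_eval_infinitePi (fun k => complexGaussian (r k)) k).lintegral_comp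
        (f := fun z => ENNReal.ofReal ((symb k : ℝ) ^ s * ‖z‖ ^ 2)) (by fun_prop)
      simp only [Function.eval] at this
      rw [this]
      simp_rw [ENNReal.ofReal_mul (hpos k)]
      rw [lintegral_const_mul _ (by fun_prop), lintegral_norm_sq_complexGaussian,
        ENNReal.ofReal_coe_nnreal]
    simp_rw [e]
    rw [← ENNReal.ofReal_tsum_of_nonneg (fun k => mul_nonneg (hpos k) (r k).coe_nonneg) hr]
    exact ENNReal.ofReal_ne_top
  filter_upwards [ae_lt_top (Measurable.tsum hm) hfin] with c hc
  refine (ENNReal.summable_toReal hc.ne).congr fun k => ?_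
  exact ENNReal.toReal_ofReal (mul_nonneg (hpos k) (by positivity))

instance : IsProbabilityMeasure gaussianMeasure := by
  unfold gaussianMeasure; infer_instance

/-- The Gaussian measure is carried by the phase space. -/
lemma map_phaseMeasure {δ : ℝ} (hδ : 0 < δ) :
    (phaseMeasure δ).map Phase.coeffs = gaussianMeasure := by
  rw [phaseMeasure, Phase.measurableEmbedding_coeffs.map_comap, Measure.restrict_eq_self_of_ae_mem]
  rw [Phase.range_coeffs]
  -- The variance supplies one more inverse power of the symbol, so both components need the same
  -- series with exponent -δ - 1.
  have h1 := ae_summable_infinitePi_complexGaussian (s := -δ) (r := fun k => 2 * (symb k)⁻¹) (by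
    refine ((summable_symb_rpow (s := -δ - 1) (by linarith)).mul_left 2).congr fun k => ?_
    rw [Real.rpow_sub_one (Sobolev.symb_pos k).ne']
    push_cast
    ring)
  have h2 := ae_summable_infinitePi_complexGaussian (s := -δ - 1) (r := fun _ => 2)
    ((summable_symb_rpow (s := -δ - 1) (by linarith)).mul_right _)
  have h3 := (Measure.quasiMeasurePreserving_fst (μ := Measure.infinitePi fun k : Freq =>
    complexGaussian (2 * (symb k)⁻¹)) (ν := Measure.infinitePi fun _ : Freq =>
    complexGaussian 2)).ae h1
  have h4 := (Measure.quasiMeasurePreserving_snd (μ := Measure.infinitePi fun k : Freq =>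
    complexGaussian (2 * (symb k)⁻¹)) (ν := Measure.infinitePi fun _ : Freq =>
    complexGaussian 2)).ae h2
  filter_upwards [h3, h4] with c hc1 hc2
  exact ⟨hc1, hc2⟩

lemma isProbabilityMeasure_phaseMeasure {δ : ℝ} (hδ : 0 < δ) :
    IsProbabilityMeasure (phaseMeasure δ) := by
  have h := map_phaseMeasure hδ
  exact (Measure.isProbabilityMeasure_map_iff
    Phase.measurable_coeffs.aemeasurable).1 (h ▸ inferInstance)

end GaussianMeasure

/-! ### Regrouping infinite products -/

section InfinitePi

variable {ι X Y : Type*} [MeasurableSpace X] [MeasurableSpace Y]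

/-- Pairs of independent sequences, as sequences of pairs. -/
lemma map_zip_infinitePi_prod (μ : ι → Measure X) (ν : ι → Measure Y)
    [∀ i, IsProbabilityMeasure (μ i)] [∀ i, IsProbabilityMeasure (ν i)] :
    ((Measure.infinitePi μ).prod (Measure.infinitePi ν)).map (fun p i => (p.1 i, p.2 i))
      = Measure.infinitePi fun i => (μ i).prod (ν i) := by
  have hz : Measurable fun (p : (ι → X) × (ι → Y)) (i : ι) => (p.1 i, p.2 i) := by fun_prop
  refine IsProjectiveLimit.unique (P := fun I : Finset ι =>
    Measure.pi fun i : I => (μ i).prod (ν i)) (fun I => ?_)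
    (Measure.isProjectiveLimit_infinitePi _)
  have hμ : (Measure.infinitePi μ).map I.restrict = Measure.pi fun i : I => μ i :=
    Measure.isProjectiveLimit_infinitePi μ I
  have hν : (Measure.infinitePi ν).map I.restrict = Measure.pi fun i : I => ν i :=
    Measure.isProjectiveLimit_infinitePi ν I
  have h := (measurePreserving_arrowProdEquivProdArrow X Y I
    (fun i : I => μ i) (fun i : I => ν i)).symm.map_eq
  change _ = Measure.pi fun i : I => (μ i).prod (ν i)
  rw [← h, ← hμ, ← hν, Measure.map_prod_map _ _ (Finset.measurable_restrict I)
    (Finset.measurable_restrict I), Measure.map_map (Finset.measurable_restrict I) hz,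
    Measure.map_map (MeasurableEquiv.arrowProdEquivProdArrow X Y I).symm.measurable
      ((Finset.measurable_restrict I).prodMap (Finset.measurable_restrict I))]
  rfl

end InfinitePi

/-! ### Transition kernels -/

section Transition

variable (ε : ℝ) (α : ℂ)

/-- The paths of all real and imaginary parts of the noise. -/
abbrev NoisePath : Type := (Freq × Fin 2) × ℝ≥0 → ℝ

/-- The noise on a Fourier mode. -/
def NoisePath.mode (w : NoisePath) (k : Freq) : ℝ≥0 → ℂ :=
  complexPath (fun t => w ((k, 0), t)) fun t => w ((k, 1), t)

/-- The solution at the time `t` on a Fourier mode. -/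
def modeStep (t : ℝ≥0) (c : (Freq → ℂ) × (Freq → ℂ)) (w : NoisePath) (k : Freq) : ℂ × ℂ :=
  flow ε α (symb k) t (c.1 k, c.2 k) + stochConv ε α (symb k) t (w.mode k)

/-- The solution at the time `t` with the initial value `x`, as a function of the noise. -/
def step {δ : ℝ} (t : ℝ≥0) (x : Phase δ) (w : NoisePath) : Phase δ :=
  Phase.ofCoeffs δ (fun k => (modeStep ε α t x.coeffs w k).1,
    fun k => (modeStep ε α t x.coeffs w k).2)

lemma measurable_noisePath_mode_stochConv {S : Type*} [MeasurableSpace S] {t : ℝ≥0}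
    {W : S → NoisePath} (hW : ∀ j, ∀ s ≤ t, Measurable fun a => W a (j, s)) (k : Freq) :
    Measurable fun a => stochConv ε α (symb k) t ((W a).mode k) := by
  refine measurable_stochConv ε α _ fun s hs => ?_
  have := hW (k, 0) s hs
  have := hW (k, 1) s hs
  unfold NoisePath.mode complexPath
  fun_prop

variable {δ : ℝ}

lemma measurable_modeStep_coeffs {S : Type*} [MeasurableSpace S] {t : ℝ≥0}
    {c : S → (Freq → ℂ) × (Freq → ℂ)} (hc : Measurable c) {W : S → NoisePath}
    (hW : ∀ j, ∀ s ≤ t, Measurable fun a => W a (j, s)) :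
    Measurable fun a => ((fun k => (modeStep ε α t (c a) (W a) k).1,
      fun k => (modeStep ε α t (c a) (W a) k).2) : (Freq → ℂ) × (Freq → ℂ)) := by
  have hk : ∀ k, Measurable fun a => modeStep ε α t (c a) (W a) k := fun k => by
    refine Measurable.add ((flow ε α (symb k) t).measurable.comp ?_)
      (measurable_noisePath_mode_stochConv ε α hW k)
    fun_prop
  exact (measurable_pi_lambda _ fun k => (hk k).fst).prodMk
    (measurable_pi_lambda _ fun k => (hk k).snd)

lemma measurable_step {S : Type*} [MeasurableSpace S] {t : ℝ≥0} {x : S → Phase δ}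
    (hx : Measurable x) {W : S → NoisePath}
    (hW : ∀ j, ∀ s ≤ t, Measurable fun a => W a (j, s)) :
    Measurable fun a => step ε α t (x a) (W a) :=
  (Phase.measurable_ofCoeffs δ).comp
    (measurable_modeStep_coeffs ε α (Phase.measurable_coeffs.comp hx) hW)

lemma measurable_step_uncurry (t : ℝ≥0) :
    Measurable fun p : Phase δ × NoisePath => step ε α t p.1 p.2 :=
  measurable_step ε α measurable_fst fun _ _ _ => (measurable_pi_apply _).comp measurable_snd

lemma measurable_step_const (t : ℝ≥0) (x : Phase δ) : Measurable (step ε α t x) :=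
  measurable_step ε α measurable_const fun _ _ _ => measurable_pi_apply _

lemma modeStep_zero (c : (Freq → ℂ) × (Freq → ℂ)) (w : NoisePath) (k : Freq) :
    modeStep ε α 0 c w k = (c.1 k, c.2 k) := by
  simp [modeStep, stochConv_zero, flow, expFlow_zero_apply]

lemma step_zero (x : Phase δ) (w : NoisePath) : step ε α 0 x w = x := by
  simp only [step, modeStep_zero]
  exact Phase.ofCoeffs_coeffs x

variable (δ) in
/-- The transition kernel at the time `t` for the noise with the law `μ`. -/
def transition (μ : Measure NoisePath) [SFinite μ] (t : ℝ≥0) : Kernel (Phase δ) (Phase δ) :=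
  (Kernel.id ×ₖ Kernel.const (Phase δ) μ).map fun p => step ε α t p.1 p.2

variable (μ : Measure NoisePath) [IsProbabilityMeasure μ]

lemma transition_apply (t : ℝ≥0) (x : Phase δ) :
    transition ε α δ μ t x = μ.map (step ε α t x) := by
  rw [transition, Kernel.map_apply _ (measurable_step_uncurry ε α t), Kernel.prod_apply,
    Kernel.id_apply, Kernel.const_apply, Measure.dirac_prod,
    Measure.map_map (measurable_step_uncurry ε α t) measurable_prodMk_left]
  rfl

instance (t : ℝ≥0) : IsMarkovKernel (transition ε α δ μ t) := by
  unfold transition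
  exact Kernel.IsMarkovKernel.map _ (measurable_step_uncurry ε α t)

/-- Fubini; questions about the kernel become questions about an initial state and an independent
noise. -/
lemma bind_transition (ν : Measure (Phase δ)) [SFinite ν] (t : ℝ≥0) :
    ν.bind (transition ε α δ μ t) = (ν.prod μ).map fun p => step ε α t p.1 p.2 := by
  have hm := measurable_step_uncurry (δ := δ) ε α t
  refine Measure.ext fun A hA => ?_
  rw [Measure.bind_apply hA (Kernel.aemeasurable _), Measure.map_apply hm hA,
    Measure.prod_apply (hm hA)]
  refine lintegral_congr fun x => ?_
  rw [transition_apply, Measure.map_apply (measurable_step_const ε α t x) hA]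
  exact congrArg μ Set.preimage_comp.symm

lemma transition_zero : transition ε α δ μ 0 = Kernel.id := by
  ext x : 1
  have e : step ε α 0 x = fun _ => x := funext (step_zero ε α x)
  rw [transition_apply, e, Measure.map_const, measure_univ, one_smul, Kernel.id_apply]

end Transition

/-! ### Law of the noise and invariance for all modes -/

section NoiseLaw

variable {Ω : Type*} {mΩ : MeasurableSpace Ω} {P : Measure Ω} [IsProbabilityMeasure P]
  {ℱ : Filtration ℝ≥0 mΩ} {β : Freq × Fin 2 → ℝ≥0 → Ω → ℝ}

omit [IsProbabilityMeasure P] in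
lemma IsCylindricalWiener.measurable (hβ : IsCylindricalWiener P ℱ β) (j : Freq × Fin 2) (t : ℝ≥0) :
    Measurable (β j t) :=
  (hβ.adapted j t).mono (ℱ.le t) le_rfl

omit [IsProbabilityMeasure P] in
lemma IsCylindricalWiener.isPlanarBrownian (hβ : IsCylindricalWiener P ℱ β) (k : Freq) :
    IsPlanarBrownian (β (k, 0)) (β (k, 1)) P where
  fst := hβ.brownian _
  snd := hβ.brownian _
  measurable_fst := hβ.measurable _
  measurable_snd := hβ.measurable _
  indep := hβ.indep.indepFun (by simp)

/-- The noise as a random path. -/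
def noisePath (β : Freq × Fin 2 → ℝ≥0 → Ω → ℝ) (ω : Ω) : NoisePath := fun p => β p.1 p.2 ω

/-- The increments of the noise after the time `s`. -/
def noiseIncrement (β : Freq × Fin 2 → ℝ≥0 → Ω → ℝ) (s : ℝ≥0) (ω : Ω) : NoisePath :=
  fun p => β p.1 (s + p.2) ω - β p.1 s ω

omit [IsProbabilityMeasure P] in
lemma IsCylindricalWiener.measurable_noisePath (hβ : IsCylindricalWiener P ℱ β) :
    Measurable (noisePath β) :=
  measurable_pi_lambda _ fun p => hβ.measurable p.1 p.2

omit [IsProbabilityMeasure P] in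
lemma IsCylindricalWiener.measurable_noiseIncrement (hβ : IsCylindricalWiener P ℱ β) (s : ℝ≥0) :
    Measurable (noiseIncrement β s) :=
  measurable_pi_lambda _ fun p => (hβ.measurable p.1 (s + p.2)).sub (hβ.measurable p.1 s)

/-- The increments of the noise after the time `s` have the law of the noise. -/
lemma IsCylindricalWiener.map_noiseIncrement (hβ : IsCylindricalWiener P ℱ β) (s : ℝ≥0) :
    P.map (noiseIncrement β s) = P.map (noisePath β) := by
  have hshift : Measurable (shiftPath (E := ℝ) s) :=
    measurable_pi_lambda _ fun t => by unfold shiftPath; fun_prop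
  have hm : ∀ j, Measurable fun ω t => β j t ω := fun j =>
    measurable_pi_lambda _ fun t => hβ.measurable j t
  have hms : ∀ j, Measurable fun ω => shiftPath s (β j · ω) := fun j => hshift.comp (hm j)
  -- Laws on the product space of paths are determined by their finite-dimensional marginals.
  have hlaw : ∀ j, P.map (fun ω => shiftPath s (β j · ω)) = P.map fun ω t => β j t ω := by
    intro j
    refine (map_eq_iff_forall_finset_map_restrict_eq (X := fun t ω => shiftPath s (β j · ω) t)
      (Y := β j) (hms j).aemeasurable (hm j).aemeasurable).2 fun I => ?_
    rw [((hβ.brownian j).hasLaw I).map_eq]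
    exact (((hβ.brownian j).shift s).hasLaw I).map_eq
  have hind : iIndepFun (fun j ω => shiftPath s (β j · ω)) P :=
    hβ.indep.comp (fun _ => shiftPath s) fun _ => hshift
  have h1 := hind.map_fun_eq_infinitePi_map hms
  have h2 := hβ.indep.map_fun_eq_infinitePi_map hm
  simp_rw [hlaw] at h1
  have hu : Measurable fun (f : Freq × Fin 2 → ℝ≥0 → ℝ) (p : (Freq × Fin 2) × ℝ≥0) =>
      f p.1 p.2 := by fun_prop
  have h3 := congrArg (Measure.map fun (f : Freq × Fin 2 → ℝ≥0 → ℝ) (p : (Freq × Fin 2) × ℝ≥0) =>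
    f p.1 p.2) (h1.trans h2.symm)
  rw [Measure.map_map hu (measurable_pi_lambda _ hms),
    Measure.map_map hu (measurable_pi_lambda _ hm)] at h3
  exact h3

lemma IsCylindricalWiener.iIndepFun_mode (hβ : IsCylindricalWiener P ℱ β) :
    iIndepFun (fun (k : Freq) ω (i : Fin 2) t => β (k, i) t ω) P := by
  have hm : ∀ j, Measurable fun ω t => β j t ω := fun j =>
    measurable_pi_lambda _ fun t => hβ.measurable j t
  have hm2 : ∀ k : Freq, Measurable fun ω (i : Fin 2) t => β (k, i) t ω := fun k =>
    measurable_pi_lambda _ fun i => hm (k, i)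
  rw [iIndepFun_iff_map_fun_eq_infinitePi_map hm2]
  have h1 : ∀ k : Freq, P.map (fun ω (i : Fin 2) t => β (k, i) t ω)
      = Measure.infinitePi fun i : Fin 2 => P.map fun ω t => β (k, i) t ω := fun k =>
    (hβ.indep.precomp (g := fun i : Fin 2 => (k, i)) fun i j h => by
      simpa using h).map_fun_eq_infinitePi_map fun i => hm (k, i)
  have : ∀ (k : Freq) (i : Fin 2), IsProbabilityMeasure (P.map fun ω t => β (k, i) t ω) :=
    fun k i => Measure.isProbabilityMeasure_map (hm (k, i)).aemeasurable
  simp_rw [h1]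
  rw [← Measure.infinitePi_map_curry (fun (k : Freq) (i : Fin 2) => P.map fun ω t => β (k, i) t ω),
    ← hβ.indep.map_fun_eq_infinitePi_map hm,
    Measure.map_map (MeasurableEquiv.measurable _) (measurable_pi_lambda _ hm)]
  rfl

variable {ε : ℝ} {α : ℂ}

/-- Convolutions of distinct modes are functions of disjoint independent blocks of the noise. -/
lemma IsCylindricalWiener.map_stochConv (hβ : IsCylindricalWiener P ℱ β) (t : ℝ≥0) :
    (P.map (noisePath β)).map (fun w k => stochConv ε α (symb k) t (w.mode k))
      = Measure.infinitePi fun k => P.map fun ω =>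
        stochConv ε α (symb k) t (complexPath (β (k, 0) · ω) (β (k, 1) · ω)) := by
  have hN : ∀ k : Freq, Measurable fun p : Fin 2 → ℝ≥0 → ℝ =>
      stochConv ε α (symb k) t (complexPath (p 0) (p 1)) := fun k =>
    measurable_stochConv ε α _ fun s _ => by unfold complexPath; fun_prop
  have h := hβ.iIndepFun_mode.comp _ hN
  have h1 := h.map_fun_eq_infinitePi_map fun k =>
    (hβ.isPlanarBrownian k).measurable_stochConv (ε := ε) (α := α) (m := symb k) t
  have hN' : Measurable fun (w : NoisePath) (k : Freq) => stochConv ε α (symb k) t (w.mode k) :=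
    measurable_pi_lambda _ fun k => measurable_noisePath_mode_stochConv ε α
      (W := id) (fun _ _ _ => measurable_pi_apply _) k
  rw [Measure.map_map hN' hβ.measurable_noisePath]
  exact h1

lemma map_zip_gaussianMeasure : gaussianMeasure.map (fun c k => (c.1 k, c.2 k))
    = Measure.infinitePi fun k => modeMeasure (symb k) :=
  map_zip_infinitePi_prod _ _

lemma gaussianMeasure_eq_map_unzip : gaussianMeasure
    = (Measure.infinitePi fun k => modeMeasure (symb k)).map
      fun v => (fun k => (v k).1, fun k => (v k).2) := by
  rw [← map_zip_gaussianMeasure, Measure.map_map (by fun_prop) (by fun_prop)]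
  exact Measure.map_id.symm

/-- The Gaussian measure is invariant for the evolution of the Fourier coefficients. -/
lemma IsCylindricalWiener.map_gaussianMeasure_prod (hβ : IsCylindricalWiener P ℱ β) (hε : ε ≠ 0)
    (hα : 0 ≤ α.re) (t : ℝ≥0) : (gaussianMeasure.prod (P.map (noisePath β))).map
      (fun p => (fun k => (modeStep ε α t p.1 p.2 k).1, fun k => (modeStep ε α t p.1 p.2 k).2))
      = gaussianMeasure := by
  have := Measure.isProbabilityMeasure_map hβ.measurable_noisePath.aemeasurable (μ := P)
  have hz : Measurable fun (c : (Freq → ℂ) × (Freq → ℂ)) (k : Freq) => (c.1 k, c.2 k) := by fun_prop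
  have hN : Measurable fun (w : NoisePath) (k : Freq) => stochConv ε α (symb k) t (w.mode k) :=
    measurable_pi_lambda _ fun k => measurable_noisePath_mode_stochConv ε α
      (W := id) (fun _ _ _ => measurable_pi_apply _) k
  have hF : ∀ k : Freq, Measurable fun p : (ℂ × ℂ) × (ℂ × ℂ) => flow ε α (symb k) t p.1 + p.2 :=
    fun k => by fun_prop
  have hG : Measurable fun (q : Freq → (ℂ × ℂ) × (ℂ × ℂ)) (k : Freq) =>
      flow ε α (symb k) t (q k).1 + (q k).2 :=
    measurable_pi_lambda _ fun k => (hF k).comp (measurable_pi_apply k)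
  have hH : Measurable fun (p : (Freq → ℂ × ℂ) × (Freq → ℂ × ℂ)) (k : Freq) =>
      flow ε α (symb k) t (p.1 k) + p.2 k :=
    hG.comp (g := fun (q : Freq → (ℂ × ℂ) × (ℂ × ℂ)) (k : Freq) =>
      flow ε α (symb k) t (q k).1 + (q k).2)
      (f := fun (p : (Freq → ℂ × ℂ) × (Freq → ℂ × ℂ)) k => (p.1 k, p.2 k)) (by fun_prop)
  have hNk : ∀ k, Measurable fun ω =>
      stochConv ε α (symb k) t (complexPath (β (k, 0) · ω) (β (k, 1) · ω)) := fun k =>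
    (hβ.isPlanarBrownian k).measurable_stochConv t
  have : ∀ k, IsProbabilityMeasure (P.map fun ω =>
      stochConv ε α (symb k) t (complexPath (β (k, 0) · ω) (β (k, 1) · ω))) := fun k =>
    Measure.isProbabilityMeasure_map (hNk k).aemeasurable
  -- Grouped by frequency, the evolution acts coordinatewise on a product measure, so invariance on
  -- one mode applies.
  have h1 : ((gaussianMeasure.map fun c k => (c.1 k, c.2 k)).prod
      ((P.map (noisePath β)).map fun w k => stochConv ε α (symb k) t (w.mode k))).map
      (fun (p : (Freq → ℂ × ℂ) × (Freq → ℂ × ℂ)) k => flow ε α (symb k) t (p.1 k) + p.2 k)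
      = Measure.infinitePi fun k => modeMeasure (symb k) := by
    have e : (fun (p : (Freq → ℂ × ℂ) × (Freq → ℂ × ℂ)) k => flow ε α (symb k) t (p.1 k) + p.2 k)
        = (fun (q : Freq → (ℂ × ℂ) × (ℂ × ℂ)) k => flow ε α (symb k) t (q k).1 + (q k).2)
          ∘ fun p k => (p.1 k, p.2 k) := rfl
    rw [map_zip_gaussianMeasure, hβ.map_stochConv, e, ← Measure.map_map hG (by fun_prop),
      map_zip_infinitePi_prod, Measure.infinitePi_map_pi _ hF]
    congr 1
    ext1 k
    exact (hβ.isPlanarBrownian k).map_modeMeasure_prod hε hα (symb_pos' k) t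
  conv_rhs => rw [gaussianMeasure_eq_map_unzip, ← h1]
  rw [Measure.map_prod_map _ _ hz hN, Measure.map_map hH (hz.prodMap hN),
    Measure.map_map (by fun_prop) (hH.comp (hz.prodMap hN))]
  rfl

end NoiseLaw

/-! ### The evolution in the phase space -/

section Pathwise

variable {ε : ℝ} {α : ℂ} {δ : ℝ}

lemma norm_add_sq_le_two_mul (a b : ℂ) : ‖a + b‖ ^ 2 ≤ 2 * (‖a‖ ^ 2 + ‖b‖ ^ 2) := by
  nlinarith [norm_add_le a b, sq_nonneg (‖a‖ - ‖b‖), norm_nonneg (a + b)]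

lemma energy_add_le {m : ℝ} (hm : 0 ≤ m) (x y : ℂ × ℂ) :
    energy m (x + y) ≤ 2 * (energy m x + energy m y) := by
  have h1 := mul_le_mul_of_nonneg_left (norm_add_sq_le_two_mul x.1 y.1) hm
  have h2 := norm_add_sq_le_two_mul x.2 y.2
  simp only [energy, Prod.fst_add, Prod.snd_add]
  linarith

/-- The integrated equation on a Fourier mode, in components. -/
lemma eq_integral_gen_iff {m : ℝ} {x : ℝ≥0 → ℂ × ℂ} (hx : Continuous x) (v x₀ : ℂ × ℂ) (c : ℂ)
    (t : ℝ≥0) :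
    v = x₀ + (∫ s in (0 : ℝ)..t, gen ε α m (x s.toNNReal)) + noiseDir ε α c ↔
      v.1 = x₀.1 + (∫ s in (0 : ℝ)..t, (ε : ℂ)⁻¹ * (x s.toNNReal).2) ∧
      v.2 = x₀.2 + (∫ s in (0 : ℝ)..t, (ε : ℂ)⁻¹ *
          (-2 * α * (ε : ℂ)⁻¹ * (x s.toNNReal).2 - (m : ℂ) * (x s.toNNReal).1))
        + 2 * (ε : ℂ)⁻¹ * (Real.sqrt α.re : ℂ) * c := by
  have hg : IntervalIntegrable (fun s : ℝ => gen ε α m (x s.toNNReal)) volume 0 t :=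
    ((gen ε α m).continuous.comp (hx.comp continuous_real_toNNReal)).intervalIntegrable _ _
  have h1 := (ContinuousLinearMap.fst ℝ ℂ ℂ).intervalIntegral_comp_comm hg
  have h2 := (ContinuousLinearMap.snd ℝ ℂ ℂ).intervalIntegral_comp_comm hg
  simp only [ContinuousLinearMap.coe_fst', ContinuousLinearMap.coe_snd', gen_apply] at h1 h2
  rw [h1, h2, Prod.ext_iff]
  simp [noiseDir_apply, gen_apply]

variable {w : NoisePath}

/-- The weight symb^{-δ-1} turns the energies into the sum of the two squared Sobolev norms. -/
lemma Phase.summable_energy (x : Phase δ) : Summable fun k =>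
    (symb k : ℝ) ^ (-δ - 1) * energy (symb k) (x.1.coeff k, x.2.coeff k) := by
  refine (x.1.summable_coeff.add x.2.summable_coeff).congr fun k => ?_
  have h := (Sobolev.symb_pos k).ne'
  simp only [energy]
  rw [Real.rpow_sub_one h]
  field_simp

lemma continuous_modeStep (hw : ∀ k, Continuous (w.mode k) ∧ w.mode k 0 = 0) (x : Phase δ)
    (k : Freq) : Continuous fun t => modeStep ε α t x.coeffs w k :=
  (continuous_expFlow_apply _ NNReal.continuous_coe continuous_const).add
    (continuous_stochConv ε α _ (hw k).1 (hw k).2)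

lemma exists_summable_bound_modeStep (hε : ε ≠ 0) (hα : 0 ≤ α.re)
    (hb : ∀ T : ℕ, ∃ b : Freq → ℝ, (Summable fun k => (symb k : ℝ) ^ (-δ - 1) * b k) ∧
      ∀ k, ∀ t : ℝ≥0, t ≤ T → energy (symb k) (stochConv ε α (symb k) t (w.mode k)) ≤ b k)
    (x : Phase δ) (T : ℕ) :
    ∃ b : Freq → ℝ, (Summable fun k => (symb k : ℝ) ^ (-δ - 1) * b k) ∧
      ∀ k, ∀ t : ℝ≥0, t ≤ T → energy (symb k) (modeStep ε α t x.coeffs w k) ≤ b k := by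
  obtain ⟨b, hb, hle⟩ := hb T
  refine ⟨fun k => 2 * (energy (symb k) (x.1.coeff k, x.2.coeff k) + b k),
    ((x.summable_energy.add hb).mul_left 2).congr fun k => by ring, fun k t ht => ?_⟩
  refine (energy_add_le (symb k).2 _ _).trans ?_
  have h1 := energy_flow_le (m := symb k) hε hα t.2 (x.1.coeff k, x.2.coeff k)
  have h2 := hle k t ht
  simp only [Phase.coeffs]
  exact mul_le_mul_of_nonneg_left (add_le_add h1 h2) zero_le_two

lemma norm_fst_sq_le_energy_div {m : ℝ} (hm : 0 < m) (x : ℂ × ℂ) :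
    ‖x.1‖ ^ 2 ≤ energy m x / m := by
  rw [le_div_iff₀ hm, energy]
  nlinarith [sq_nonneg ‖x.2‖]

lemma norm_snd_sq_le_energy {m : ℝ} (hm : 0 ≤ m) (x : ℂ × ℂ) : ‖x.2‖ ^ 2 ≤ energy m x := by
  rw [energy]
  nlinarith [mul_nonneg hm (sq_nonneg ‖x.1‖)]

lemma rpow_mul_div_symb (δ b : ℝ) (k : Freq) :
    (symb k : ℝ) ^ (-δ) * (b / symb k) = (symb k : ℝ) ^ (-δ - 1) * b := by
  have h := (Sobolev.symb_pos k).ne'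
  rw [Real.rpow_sub_one h]
  field_simp

variable (hε : ε ≠ 0) (hα : 0 ≤ α.re)
  (hb : ∀ T : ℕ, ∃ b : Freq → ℝ, (Summable fun k => (symb k : ℝ) ^ (-δ - 1) * b k) ∧
    ∀ k, ∀ t : ℝ≥0, t ≤ T → energy (symb k) (stochConv ε α (symb k) t (w.mode k)) ≤ b k)
include hε hα hb

/-- The energy bounds rule out the default value 0 of `Sobolev.ofCoeff`. -/
lemma coeffs_step (x : Phase δ) (t : ℝ≥0) : (step ε α t x w).coeffs
    = (fun k => (modeStep ε α t x.coeffs w k).1, fun k => (modeStep ε α t x.coeffs w k).2) := by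
  obtain ⟨T, hT⟩ := exists_nat_ge t
  obtain ⟨b, hb, hle⟩ := exists_summable_bound_modeStep hε hα hb x T
  have hpos : ∀ (r : ℝ) (k : Freq), 0 ≤ (symb k : ℝ) ^ r := fun r k =>
    Real.rpow_nonneg (Sobolev.symb_pos k).le _
  refine Prod.ext (Sobolev.coeff_ofCoeff ?_) (Sobolev.coeff_ofCoeff ?_)
  · refine hb.of_nonneg_of_le (fun k => mul_nonneg (hpos _ _) (sq_nonneg _)) fun k => ?_
    rw [← rpow_mul_div_symb]
    refine mul_le_mul_of_nonneg_left ?_ (hpos _ _)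
    exact (norm_fst_sq_le_energy_div (Sobolev.symb_pos k) _).trans
      (div_le_div_of_nonneg_right (hle k t hT) (symb k).2)
  · refine hb.of_nonneg_of_le (fun k => mul_nonneg (hpos _ _) (sq_nonneg _)) fun k => ?_
    exact mul_le_mul_of_nonneg_left ((norm_snd_sq_le_energy (symb k).2 _).trans (hle k t hT))
      (hpos _ _)

lemma coeff_fst_step (x : Phase δ) (t : ℝ≥0) (k : Freq) :
    (step ε α t x w).1.coeff k = (modeStep ε α t x.coeffs w k).1 :=
  congrFun (congrArg Prod.fst (coeffs_step hε hα hb x t)) k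

lemma coeff_snd_step (x : Phase δ) (t : ℝ≥0) (k : Freq) :
    (step ε α t x w).2.coeff k = (modeStep ε α t x.coeffs w k).2 :=
  congrFun (congrArg Prod.snd (coeffs_step hε hα hb x t)) k

lemma continuous_step (hw : ∀ k, Continuous (w.mode k) ∧ w.mode k 0 = 0) (x : Phase δ) :
    Continuous fun t => step ε α t x w := by
  have h1 := coeff_fst_step hε hα hb x
  have h2 := coeff_snd_step hε hα hb x
  have hs := exists_summable_bound_modeStep hε hα hb x
  refine Continuous.prodMk (f := fun t => (step ε α t x w).1) (g := fun t => (step ε α t x w).2)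
    (Sobolev.continuous_of_coeff (fun k => ?_) fun T => ?_)
    (Sobolev.continuous_of_coeff (fun k => ?_) fun T => ?_)
  · simp only [h1]
    exact (continuous_modeStep hw x k).fst
  · obtain ⟨b, hb, hle⟩ := hs T
    refine ⟨fun k => b k / symb k, hb.congr fun k => (rpow_mul_div_symb _ _ _).symm,
      fun k t ht => ?_⟩
    rw [h1]
    exact (norm_fst_sq_le_energy_div (Sobolev.symb_pos k) _).trans
      (div_le_div_of_nonneg_right (hle k t ht) (symb k).2)
  · simp only [h2]
    exact (continuous_modeStep hw x k).snd
  · obtain ⟨b, hb, hle⟩ := hs T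
    refine ⟨b, hb, fun k t ht => ?_⟩
    rw [h2]
    exact (norm_snd_sq_le_energy (symb k).2 _).trans (hle k t ht)

end Pathwise

/-! ### Existence, Markov property, invariance -/

section Solutions

variable {Ω : Type*} {mΩ : MeasurableSpace Ω} {P : Measure Ω} [IsProbabilityMeasure P]
  {ℱ : Filtration ℝ≥0 mΩ} {β : Freq × Fin 2 → ℝ≥0 → Ω → ℝ} {ε : ℝ} {α : ℂ} {δ : ℝ}

omit [IsProbabilityMeasure P] in
lemma IsCylindricalWiener.ae_continuous_mode (hβ : IsCylindricalWiener P ℱ β) : ∀ᵐ ω ∂P, ∀ k,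
    Continuous ((noisePath β ω).mode k) ∧ (noisePath β ω).mode k 0 = 0 :=
  ae_all_iff.2 fun k => (hβ.isPlanarBrownian k).ae_continuous

/-- The process `t ↦ step t x W` is a solution. -/
lemma IsCylindricalWiener.isSolution_step (hβ : IsCylindricalWiener P ℱ β) (hε : ε ≠ 0)
    (hα : 0 ≤ α.re) (hδ : 0 < δ) (x : Phase δ) :
    IsSolution P ℱ β ε α δ fun t ω => step ε α t x (noisePath β ω) := by
  have hbound : ∀ᵐ ω ∂P, ∀ T : ℕ, ∃ b : Freq → ℝ,
      (Summable fun k => (symb k : ℝ) ^ (-δ - 1) * b k) ∧ ∀ k, ∀ t : ℝ≥0, t ≤ T →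
        energy (symb k) (stochConv ε α (symb k) t ((noisePath β ω).mode k)) ≤ b k :=
    ae_exists_summable_bound hβ.isPlanarBrownian hε hα (by linarith)
  have heq : ∀ᵐ ω ∂P, ∀ (t : ℝ≥0) (k : Freq),
      modeStep ε α t x.coeffs (noisePath β ω) k = (x.1.coeff k, x.2.coeff k)
        + (∫ s in (0 : ℝ)..t, gen ε α (symb k) (modeStep ε α s.toNNReal x.coeffs (noisePath β ω) k))
        + noiseDir ε α ((noisePath β ω).mode k t) := by
    filter_upwards [hβ.ae_continuous_mode] with ω hω t k
    exact flow_add_stochConv_eq_integral ε α (symb k) (hω k).1 (hω k).2 _ t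
  have hcoeffs : ∀ᵐ ω ∂P, (∀ t k, (step ε α t x (noisePath β ω)).1.coeff k
      = (modeStep ε α t x.coeffs (noisePath β ω) k).1) ∧
      ∀ t k, (step ε α t x (noisePath β ω)).2.coeff k
      = (modeStep ε α t x.coeffs (noisePath β ω) k).2 := by
    filter_upwards [hbound] with ω hω
    exact ⟨coeff_fst_step hε hα hω x, coeff_snd_step hε hα hω x⟩
  refine ⟨fun t => ⟨_, ?_, ae_eq_rfl⟩, ?_, ?_, ?_⟩
  · exact @measurable_step ε α δ Ω (ℱ t) _ _ measurable_const _ fun j s hs =>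
      (hβ.adapted j s).mono (ℱ.mono hs) le_rfl
  · filter_upwards [hbound, hβ.ae_continuous_mode] with ω hω hc
    exact continuous_step hε hα hω hc x
  · filter_upwards [hcoeffs, hβ.ae_continuous_mode, heq] with ω hω hc he t k
    have h := ((eq_integral_gen_iff (continuous_modeStep hc x k) _ _ _ t).1 (he t k)).1
    simp only [hω.1, hω.2, modeStep_zero]
    exact h
  · filter_upwards [hcoeffs, hβ.ae_continuous_mode, heq] with ω hω hc he t k
    have h := ((eq_integral_gen_iff (continuous_modeStep hc x k) _ _ _ t).1 (he t k)).2
    simp only [hω.1, hω.2, modeStep_zero]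
    exact h

omit [IsProbabilityMeasure P] in
/-- Every solution is restarted at the time `s` with the increments of the noise after `s`. -/
lemma IsSolution.ae_eq_step {X : ℝ≥0 → Ω → Phase δ} (hX : IsSolution P ℱ β ε α δ X)
    (hβ : IsCylindricalWiener P ℱ β) : ∀ᵐ ω ∂P, ∀ s t : ℝ≥0,
      X (s + t) ω = step ε α t (X s ω) (noiseIncrement β s ω) := by
  filter_upwards [hX.continuous_paths, hX.eq_Z, hX.eq_Y, hβ.ae_continuous_mode] with ω hc hZ hY hw s t
  have hk : ∀ k, modeStep ε α t (X s ω).coeffs (noiseIncrement β s ω) k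
      = ((X (s + t) ω).1.coeff k, (X (s + t) ω).2.coeff k) := by
    intro k
    have hx : Continuous fun u => ((X u ω).1.coeff k, (X u ω).2.coeff k) :=
      ((Sobolev.continuous_coeff k).comp hc.fst).prodMk ((Sobolev.continuous_coeff k).comp hc.snd)
    have h := restart_eq_flow_add_stochConv ε α (symb k) (hw k).1 hx
      (x₀ := ((X 0 ω).1.coeff k, (X 0 ω).2.coeff k))
      (fun t => (eq_integral_gen_iff hx _ _ _ t).2 ⟨hZ t k, hY t k⟩) s t
    rw [h, NoisePath.mode, shiftPath_complexPath]
    rfl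
  -- No energy bound is needed: the coefficients are those of X(s + t), already an element of the
  -- phase space.
  simp only [step, hk]
  exact (Phase.ofCoeffs_coeffs _).symm

/-- The noise after the time `s` is independent of the past. -/
lemma IsCylindricalWiener.map_restrict_prodMk_noiseIncrement (hβ : IsCylindricalWiener P ℱ β)
    (s : ℝ≥0) {S : Type*} [MeasurableSpace S] {g : Ω → S} (hg : Measurable[ℱ s] g) {B : Set Ω}
    (hB : MeasurableSet[ℱ s] B) : (P.restrict B).map (fun ω => (g ω, noiseIncrement β s ω))
      = ((P.restrict B).map g).prod (P.map (noisePath β)) := by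
  have hg' : Measurable g := hg.mono (ℱ.le s) le_rfl
  have hW := hβ.measurable_noiseIncrement s
  refine (Measure.prod_eq fun C D hC hD => ?_).symm
  rw [Measure.map_apply (hg'.prodMk hW) (hC.prod hD), Measure.map_apply hg' hC,
    ← hβ.map_noiseIncrement s, Measure.map_apply hW hD,
    Measure.restrict_apply ((hg'.prodMk hW) (hC.prod hD)), Measure.restrict_apply (hg' hC)]
  have h := (Indep_iff _ _ P).1 (hβ.indep_past s) (noiseIncrement β s ⁻¹' D) (g ⁻¹' C ∩ B)
    ⟨D, hD, rfl⟩ (MeasurableSet.inter (hg hC) hB)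
  rw [mul_comm, ← h]
  congr 1
  ext ω
  simp only [Set.mem_inter_iff, Set.mem_preimage, Set.mem_prod]
  tauto

lemma IsCylindricalWiener.isProbabilityMeasure_map_noisePath (hβ : IsCylindricalWiener P ℱ β) :
    IsProbabilityMeasure (P.map (noisePath β)) :=
  Measure.isProbabilityMeasure_map hβ.measurable_noisePath.aemeasurable

/-- Events `B` of the past produce the set integrals that characterise the conditional expectation;
the whole space gives Chapman–Kolmogorov. -/
lemma IsCylindricalWiener.map_restrict_step (hβ : IsCylindricalWiener P ℱ β)
    (s t : ℝ≥0) {g : Ω → Phase δ} (hg : Measurable[ℱ s] g) {B : Set Ω}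
    (hB : MeasurableSet[ℱ s] B) :
    (P.restrict B).map (fun ω => step ε α t (g ω) (noiseIncrement β s ω))
      = ((P.restrict B).map g).bind (transition ε α δ (P.map (noisePath β)) t) := by
  have := hβ.isProbabilityMeasure_map_noisePath
  have hg' : Measurable g := hg.mono (ℱ.le s) le_rfl
  rw [bind_transition, ← hβ.map_restrict_prodMk_noiseIncrement s hg hB,
    Measure.map_map (measurable_step_uncurry ε α t)
      (hg'.prodMk (hβ.measurable_noiseIncrement s))]
  rfl

/-- The Markov property of the solutions. -/
lemma IsSolution.condExp_eq {X : ℝ≥0 → Ω → Phase δ} (hX : IsSolution P ℱ β ε α δ X)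
    (hβ : IsCylindricalWiener P ℱ β) (s t : ℝ≥0) {A : Set (Phase δ)} (hA : MeasurableSet A) :
    P[(X (s + t) ⁻¹' A).indicator (fun _ => (1 : ℝ)) | ℱ s]
      =ᵐ[P] fun ω => (transition ε α δ (P.map (noisePath β)) t (X s ω)).real A := by
  have := hβ.isProbabilityMeasure_map_noisePath
  -- Solutions are adapted only up to null sets, so X(s) is replaced by an `ℱ s`-measurable version.
  obtain ⟨g, hg, hXg⟩ := hX.adapted s
  have hg' : Measurable g := hg.mono (ℱ.le s) le_rfl
  set κ := transition ε α δ (P.map (noisePath β)) t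
  set Y : Ω → Phase δ := fun ω => step ε α t (g ω) (noiseIncrement β s ω)
  have hY : Measurable Y := measurable_step ε α hg' fun j u _ =>
    (measurable_pi_apply _).comp (hβ.measurable_noiseIncrement s)
  have h1 : (X (s + t) ⁻¹' A).indicator (fun _ => (1 : ℝ))
      =ᵐ[P] (Y ⁻¹' A).indicator fun _ => (1 : ℝ) := by
    filter_upwards [hX.ae_eq_step hβ, hXg] with ω h1 h2
    have : X (s + t) ω = Y ω := by rw [h1 s t, h2]
    exact congrArg (A.indicator fun _ => (1 : ℝ)) this
  have h2 : (fun ω => (κ (X s ω)).real A) =ᵐ[P] fun ω => (κ (g ω)).real A := by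
    filter_upwards [hXg] with ω h
    rw [h]
  have hκ : Measurable fun x => (κ x).real A := (κ.measurable_coe hA).ennreal_toReal
  have hκi : ∀ B, IntegrableOn (fun ω => (κ (g ω)).real A) B P := fun B =>
    (Integrable.of_bound (hκ.comp hg').aestronglyMeasurable 1
      (ae_of_all _ fun ω => by
        exact (Real.norm_of_nonneg measureReal_nonneg).trans_le measureReal_le_one)).integrableOn
  refine (condExp_congr_ae h1).trans (EventuallyEq.trans ?_ h2.symm)
  refine (ae_eq_condExp_of_forall_setIntegral_eq (ℱ.le s)
    ((integrable_const 1).indicator (hY hA)) (fun B _ _ => hκi B) (fun B hB _ => ?_)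
    (hκ.comp hg).stronglyMeasurable.aestronglyMeasurable).symm
  have hlaw := congrArg (fun μ => μ.real A) (hβ.map_restrict_step (ε := ε) (α := α) s t hg hB)
  simp only [measureReal_def] at hlaw
  rw [Measure.map_apply hY hA, Measure.bind_apply hA (Kernel.aemeasurable _),
    lintegral_map (κ.measurable_coe hA) hg'] at hlaw
  rw [integral_indicator (hY hA), setIntegral_const, smul_eq_mul, mul_one, measureReal_def, hlaw]
  exact integral_toReal ((κ.measurable_coe hA).comp hg').aemeasurable
    (ae_of_all _ fun ω => measure_lt_top _ _)

/-- The Chapman–Kolmogorov equations. -/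
lemma IsCylindricalWiener.transition_add (hβ : IsCylindricalWiener P ℱ β) (hε : ε ≠ 0)
    (hα : 0 ≤ α.re) (hδ : 0 < δ) (s t : ℝ≥0) :
    transition ε α δ (P.map (noisePath β)) (s + t)
      = (transition ε α δ (P.map (noisePath β)) t).comp
        (transition ε α δ (P.map (noisePath β)) s) := by
  have := hβ.isProbabilityMeasure_map_noisePath
  refine Kernel.ext fun x => ?_
  have hg : Measurable[ℱ s] fun ω => step ε α s x (noisePath β ω) :=
    @measurable_step ε α δ Ω (ℱ s) _ _ measurable_const _ fun j u hu =>
      (hβ.adapted j u).mono (ℱ.mono hu) le_rfl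
  have hlaw := hβ.map_restrict_step (ε := ε) (α := α) s t hg MeasurableSet.univ
  rw [Measure.restrict_univ] at hlaw
  have h1 : ∀ u, transition ε α δ (P.map (noisePath β)) u x
      = P.map fun ω => step ε α u x (noisePath β ω) := fun u => by
    rw [transition_apply, Measure.map_map (measurable_step_const ε α u x) hβ.measurable_noisePath]
    rfl
  rw [Kernel.comp_apply, h1, h1 s, ← hlaw]
  refine Measure.map_congr ?_
  filter_upwards [(hβ.isSolution_step hε hα hδ x).ae_eq_step hβ] with ω h
  exact h s t

lemma IsCylindricalWiener.isTransitionSemigroup (hβ : IsCylindricalWiener P ℱ β) (hε : ε ≠ 0)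
    (hα : 0 ≤ α.re) (hδ : 0 < δ) :
    IsTransitionSemigroup P ℱ β ε α δ (transition ε α δ (P.map (noisePath β))) := by
  have := hβ.isProbabilityMeasure_map_noisePath
  exact ⟨fun t => inferInstance, transition_zero ε α _, hβ.transition_add hε hα hδ,
    fun X hX s t A hA => hX.condExp_eq hβ s t hA⟩

/-- `Phase.ofCoeffs` is applied to both sides of the invariance for coefficients; being a left
inverse of `Phase.coeffs`, it returns `phaseMeasure` on one side and the law of `step` on the other.
-/
lemma IsCylindricalWiener.invariant_transition (hβ : IsCylindricalWiener P ℱ β) (hε : ε ≠ 0)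
    (hα : 0 ≤ α.re) (hδ : 0 < δ) (t : ℝ≥0) :
    (transition ε α δ (P.map (noisePath β)) t).Invariant (phaseMeasure δ) := by
  have := hβ.isProbabilityMeasure_map_noisePath
  have := isProbabilityMeasure_phaseMeasure hδ
  have hF : Measurable fun p : ((Freq → ℂ) × (Freq → ℂ)) × NoisePath =>
      ((fun k => (modeStep ε α t p.1 p.2 k).1, fun k => (modeStep ε α t p.1 p.2 k).2) :
        (Freq → ℂ) × (Freq → ℂ)) := 
    measurable_modeStep_coeffs ε α measurable_fst
      fun _ _ _ => (measurable_pi_apply _).comp measurable_snd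
  have hcm := Phase.measurable_coeffs (δ := δ)
  have h := congrArg (Measure.map (Phase.ofCoeffs δ)) (hβ.map_gaussianMeasure_prod hε hα t)
  have e : (phaseMeasure δ).map (Phase.ofCoeffs δ ∘ Phase.coeffs) = phaseMeasure δ := by
    rw [show Phase.ofCoeffs δ ∘ Phase.coeffs = id from funext Phase.ofCoeffs_coeffs,
      Measure.map_id]
  rw [← map_phaseMeasure hδ, Measure.map_map (Phase.measurable_ofCoeffs δ) hcm, e] at h
  nth_rewrite 1 [← Measure.map_id (μ := P.map (noisePath β))] at h
  rw [Measure.map_prod_map _ _ hcm measurable_id, Measure.map_map hF (hcm.prodMap measurable_id),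
    Measure.map_map (Phase.measurable_ofCoeffs δ) (hF.comp (hcm.prodMap measurable_id))] at h
  rw [Kernel.Invariant, bind_transition]
  exact h

end Solutions

end KleinGordon

end

theorem proposition3p2 {Ω : Type*} [mΩ : MeasurableSpace Ω] (P : Measure Ω)
    [IsProbabilityMeasure P] (ℱ : Filtration ℝ≥0 mΩ)
    (β : KleinGordon.Freq × Fin 2 → ℝ≥0 → Ω → ℝ)
    (hβ : KleinGordon.IsCylindricalWiener P ℱ β)
    (ε : ℝ) (hε : 0 < ε) (α : ℂ) (hα : 0 < α.re) (δ : ℝ) (hδ : 0 < δ) :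
    -- the process exists from every starting point of the phase space
    (∀ x : KleinGordon.Phase δ, ∃ X : ℝ≥0 → Ω → KleinGordon.Phase δ,
      KleinGordon.IsSolution P ℱ β ε α δ X ∧ ∀ᵐ ω ∂P, X 0 ω = x) ∧
    -- the Gaussian measure is carried by the phase space
    (KleinGordon.phaseMeasure δ).map KleinGordon.Phase.coeffs = KleinGordon.gaussianMeasure ∧
    -- the process is Markov, and the Gaussian measure is invariant for its transition semigroup
    ∃ Q : ℝ≥0 → Kernel (KleinGordon.Phase δ) (KleinGordon.Phase δ),
      KleinGordon.IsTransitionSemigroup P ℱ β ε α δ Q ∧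
      ∀ t, (Q t).Invariant (KleinGordon.phaseMeasure δ) := by
  have hε' := hε.ne'
  exact ⟨fun x => ⟨_, hβ.isSolution_step hε' hα.le hδ x,
      ae_of_all _ fun ω => KleinGordon.step_zero ε α x _⟩,
    KleinGordon.map_phaseMeasure hδ,
    _, hβ.isTransitionSemigroup hε' hα.le hδ, hβ.invariant_transition hε' hα.le hδ⟩
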